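/- Computations are carried out in the standard model of floating-point arithmetic with unit round-off $u>0$: each operation $+,-,\cdot,/,\sqrt{\ }$ returns the exact result times $1+\delta$ for some $|\delta|\le u$. Write $\gamma_k=ku/(1-ku)$, let $\|\cdot\|_2$ be the spectral norm, $M^\dagger$ the Moore–Penrose pseudo-inverse, and $\kappa_2(M)=\|M\|_2\|M^\dagger\|_2$ if $M$ has linearly independent columns, $\kappa_2(M)=\infty$ otherwise. There is an absolute integer constant $c\ge 1$ (the constant of the Householder QR error bound, $\tilde\gamma_{sn}:=\gamma_{csn}$) such that the following holds. Let $m>s>n$, let $A\in\mathbb{R}^{m\times n}$ have linearly independent columns and $S\in\mathbb{R}^{s\times m}$ linearly independent rows, let $A=Q_AR_A$ be an economized QR factorization, and suppose $mu<1$, $csnu<1$. Put $$C_1=\sqrt{sn}\,\gamma_m+\sqrt n\,\tilde\gamma_{sn}\,(1+\sqrt{sn}\,\gamma_m),\qquad k(S)=\|S\|_2\|(SQ_A)^\dagger\|_2,$$ and assume $$\kappa_2(SQ_A)<49,\qquad n^2u<\tfrac1{201},\qquad \tfrac mn+\sqrt n>200,\qquad \kappa_2(A)<\frac1{3C_1k(S)}.$$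 Let $\hat B$ be the product $SA$ computed by the standard algorithm, $\hat R$ the triangular factor computed from $\hat B$ by the Householder QR algorithm, and $\hat Y$ the matrix computed from $A\hat R^{-1}$ by forward substitution applied to the rows. Let $b,\delta b\in\mathbb{R}^m$ and $\Delta\hat Y\in\mathbb{R}^{m\times n}$, suppose that the least squares solver LSQR applied to $\hat Yz=b$ returns $$\hat z=(\hat Y+\Delta\hat Y)^\dagger(b+\delta b),$$ and let $\hat x$ be computed from $\hat Rx=\hat z$ by back substitution. Then there is $\Delta A\in\mathbb{R}^{m\times n}$ such that $\hat x$ solves the least squares problem $\min_x\|(A+\Delta A)x-(b+\delta b)\|_2$ and $$\|\Delta A\|_2<\|S\|_2\|A\|_2\left(6.04\,n\gamma_n\,\|(SQ_A)^\dagger\|_2+2.01\,\|\Delta\hat Y\|_2\right).$$ -/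

import Mathlib

open scoped Matrix Matrix.Norms.L2Operator ENNReal

namespace SketchApply

/-! ### Pseudo-inverse, condition number, QR factorization, least squares

`‖M‖` for a matrix `M` is the spectral norm throughout. -/

/-- `P` is the Moore–Penrose pseudo-inverse of the real matrix `M`. -/
structure IsMoorePenrose {m n : ℕ} (M : Matrix (Fin m) (Fin n) ℝ)
    (P : Matrix (Fin n) (Fin m) ℝ) : Prop where
  mul_mul : M * P * M = M
  mul_mul' : P * M * P = P
  symm_left : (M * P)ᵀ = M * P
  symm_right : (P * M)ᵀ = P * M

theorem exists_isMoorePenrose {m n : ℕ} (M : Matrix (Fin m) (Fin n) ℝ) :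
    ∃ P, IsMoorePenrose M P := by
  have hG : IsSelfAdjoint (Mᵀ * M) := by
    rw [IsSelfAdjoint, Matrix.star_eq_conjTranspose, Matrix.conjTranspose_eq_transpose_of_trivial,
      Matrix.transpose_mul, Matrix.transpose_transpose]
  obtain ⟨g, hgs, hcomm, h1, h2⟩ : ∃ g : Matrix (Fin n) (Fin n) ℝ, gᵀ = g ∧
      g * (Mᵀ * M) = (Mᵀ * M) * g ∧
      (Mᵀ * M) * g * (Mᵀ * M) = Mᵀ * M ∧ g * (Mᵀ * M) * g = g := by
    have hfin : (spectrum ℝ (Mᵀ * M)).Finite := Matrix.finite_real_spectrum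
    have hc : ∀ f : ℝ → ℝ, ContinuousOn f (spectrum ℝ (Mᵀ * M)) := fun f => hfin.continuousOn f
    refine ⟨cfc (fun x : ℝ => x⁻¹) (Mᵀ * M), ?_, ?_, ?_, ?_⟩
    · have := cfc_predicate (R := ℝ) (fun x : ℝ => x⁻¹) (Mᵀ * M)
      rwa [IsSelfAdjoint, Matrix.star_eq_conjTranspose,
        Matrix.conjTranspose_eq_transpose_of_trivial] at this
    · nth_rewrite 2 [← cfc_id' ℝ (Mᵀ * M)]
      nth_rewrite 3 [← cfc_id' ℝ (Mᵀ * M)]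
      exact (cfc_commute_cfc _ _ _).eq
    · nth_rewrite 1 [← cfc_id' ℝ (Mᵀ * M)]
      nth_rewrite 3 [← cfc_id' ℝ (Mᵀ * M)]
      rw [← cfc_mul _ _ _ (hc _) (hc _), ← cfc_mul _ _ _ (hc _) (hc _)]
      conv_rhs => rw [← cfc_id' ℝ (Mᵀ * M)]
      congr 1
      funext x
      exact mul_inv_mul_cancel x
    · nth_rewrite 2 [← cfc_id' ℝ (Mᵀ * M)]
      rw [← cfc_mul _ _ _ (hc _) (hc _), ← cfc_mul _ _ _ (hc _) (hc _)]
      congr 1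
      funext x
      simpa using mul_inv_mul_cancel x⁻¹
  refine ⟨g * Mᵀ, ?_, ?_, ?_, ?_⟩
  · have h0 : (M * g * (Mᵀ * M) - M)ᵀ * (M * g * (Mᵀ * M) - M) = 0 := by
      have e : Mᵀ * (M * g * (Mᵀ * M) - M) = 0 := by
        rw [Matrix.mul_sub, ← Matrix.mul_assoc Mᵀ (M * g), ← Matrix.mul_assoc Mᵀ M g, h1, sub_self]
      have e' : (M * g * (Mᵀ * M) - M)ᵀ = (Mᵀ * M * g - 1) * Mᵀ := by
        simp only [Matrix.transpose_sub, Matrix.transpose_mul, Matrix.transpose_transpose, hgs,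
          Matrix.sub_mul, Matrix.one_mul, Matrix.mul_assoc]
      rw [e', Matrix.mul_assoc, e, Matrix.mul_zero]
    rw [← Matrix.conjTranspose_eq_transpose_of_trivial] at h0
    have := sub_eq_zero.mp (Matrix.conjTranspose_mul_self_eq_zero.mp h0)
    simpa only [Matrix.mul_assoc] using this
  · rw [Matrix.mul_assoc g Mᵀ M, ← Matrix.mul_assoc, h2]
  · simp only [Matrix.transpose_mul, Matrix.transpose_transpose, hgs, Matrix.mul_assoc]
  · rw [Matrix.mul_assoc g, Matrix.transpose_mul, hgs, Matrix.transpose_mul,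
      Matrix.transpose_transpose, hcomm]

/-- The Moore–Penrose pseudo-inverse `M†` (the four conditions have exactly one solution). -/
noncomputable def pinv {m n : ℕ} (M : Matrix (Fin m) (Fin n) ℝ) : Matrix (Fin n) (Fin m) ℝ :=
  (exists_isMoorePenrose M).choose

theorem pinv_spec {m n : ℕ} (M : Matrix (Fin m) (Fin n) ℝ) : IsMoorePenrose M (pinv M) :=
  (exists_isMoorePenrose M).choose_spec

open Classical in
/-- The spectral condition number `κ₂(M) = ‖M‖₂ ‖M†‖₂` of a matrix with linearly independent
columns; it is `∞` when the columns are linearly dependent. -/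
noncomputable def condNum {m n : ℕ} (M : Matrix (Fin m) (Fin n) ℝ) : ℝ≥0∞ :=
  if LinearIndependent ℝ M.col then ENNReal.ofReal (‖M‖ * ‖pinv M‖) else ⊤

/-- `A = Q R` is an economized QR factorization. -/
structure IsEconomyQR {m n : ℕ} (A Q : Matrix (Fin m) (Fin n) ℝ)
    (R : Matrix (Fin n) (Fin n) ℝ) : Prop where
  orthonormal : Qᵀ * Q = 1
  upper : ∀ i j, j < i → R i j = 0
  eq : A = Q * R

/-- `x` is a solution of the least squares problem `min_y ‖M y - b‖₂`. -/
def IsLeastSquaresSolution {m n : ℕ} (M : Matrix (Fin m) (Fin n) ℝ) (b : Fin m → ℝ)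
    (x : Fin n → ℝ) : Prop :=
  ∀ y : Fin n → ℝ, ‖WithLp.toLp 2 (M *ᵥ x - b)‖ ≤ ‖WithLp.toLp 2 (M *ᵥ y - b)‖

/-! ### Floating-point arithmetic with unit round-off `u`

Standard model: the computed value of one operation `+, -, *, /, √` is the exact value times
`1 + δ` with `|δ| ≤ u`. An algorithm is described by the relation between its input and every
output that it can produce when each operation commits such an arbitrary error. -/

/-- `y` is a possible computed value for an operation whose exact result is `x`. -/
def Rounds (u x y : ℝ) : Prop := ∃ δ : ℝ, |δ| ≤ u ∧ y = x * (1 + δ)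

/-- `r` is computed from `c + ∑ aᵢ bᵢ`, adding the products to `c` one after the other. -/
def FlAddDot (u : ℝ) : List (ℝ × ℝ) → ℝ → ℝ → Prop
  | [], c, r => r = c
  | ab :: l, c, r => ∃ p c', Rounds u (ab.1 * ab.2) p ∧ Rounds u (c + p) c' ∧ FlAddDot u l c' r

/-- `r` is computed from the inner product `∑ aᵢ bᵢ` by recursive summation (the first
product is the initial value, so that `k` terms take `k - 1` additions). -/
def FlDot (u : ℝ) : List (ℝ × ℝ) → ℝ → Prop
  | [], r => r = 0
  | ab :: l, r => ∃ p, Rounds u (ab.1 * ab.2) p ∧ FlAddDot u l p r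

/-- `r` is computed from `c - ∑ aᵢ bᵢ`, subtracting the products from `c` one after the other. -/
def FlSubDot (u : ℝ) : List (ℝ × ℝ) → ℝ → ℝ → Prop
  | [], c, r => r = c
  | ab :: l, c, r => ∃ p c', Rounds u (ab.1 * ab.2) p ∧ Rounds u (c - p) c' ∧ FlSubDot u l c' r

/-- `C` is computed from `A * B` by the standard algorithm. -/
def FlMatMul (u : ℝ) {m n p : ℕ} (A : Matrix (Fin m) (Fin n) ℝ) (B : Matrix (Fin n) (Fin p) ℝ)
    (C : Matrix (Fin m) (Fin p) ℝ) : Prop :=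
  ∀ i j, FlDot u (List.ofFn fun k => (A i k, B k j)) (C i j)

/-- `y` is computed from the lower triangular system `Rᵀ y = a` by forward substitution:
`y_j = (a_j - ∑_{k < j} R_{kj} y_k) / R_{jj}`. -/
def FlForwardSub (u : ℝ) {n : ℕ} (R : Matrix (Fin n) (Fin n) ℝ) (a y : Fin n → ℝ) : Prop :=
  ∀ j, ∃ t, FlSubDot u (((List.finRange n).filter (· < j)).map fun k => (R k j, y k)) (a j) t ∧
    Rounds u (t / R j j) (y j)

/-- `x` is computed from the upper triangular system `R x = z` by back substitution:
`x_i = (z_i - ∑_{k > i} R_{ik} x_k) / R_{ii}`. -/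
def FlBackSub (u : ℝ) {n : ℕ} (R : Matrix (Fin n) (Fin n) ℝ) (z x : Fin n → ℝ) : Prop :=
  ∀ i, ∃ t, FlSubDot u (((List.finRange n).filter (i < ·)).map fun k => (R i k, x k)) (z i) t ∧
    Rounds u (t / R i i) (x i)

/-- `Y` is computed from `A R⁻¹` by forward substitution on the systems `Rᵀ yᵢ = aᵢ`, where `aᵢ`
and `yᵢ` are the rows of `A` and `Y`. -/
def FlRightTriSolve (u : ℝ) {m n : ℕ} (R : Matrix (Fin n) (Fin n) ℝ)
    (A Y : Matrix (Fin m) (Fin n) ℝ) : Prop :=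
  ∀ i, FlForwardSub u R (A i) (Y i)

/-- `σ` is computed from `sign(x₀) ‖x‖₂`, with `sign(0) = 1`. -/
def FlSignedNorm (u : ℝ) {k : ℕ} (x : Fin (k + 1) → ℝ) (σ : ℝ) : Prop :=
  ∃ d t, FlDot u (List.ofFn fun i => (x i, x i)) d ∧ Rounds u (Real.sqrt d) t ∧
    σ = if 0 ≤ x 0 then t else -t

/-- `v` and `β` are computed from the Householder vector `v = x + σ e₀` and the scalar
`β = 1 / (σ v₀)`, which define the reflector `I - β v vᵀ` mapping `x` to `-σ e₀`. -/
def FlHouseholderVector (u : ℝ) {k : ℕ} (x : Fin (k + 1) → ℝ) (σ : ℝ) (v : Fin (k + 1) → ℝ)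
    (β : ℝ) : Prop :=
  Rounds u (x 0 + σ) (v 0) ∧ (∀ i : Fin k, v i.succ = x i.succ) ∧
    ∃ p, Rounds u (σ * v 0) p ∧ Rounds u (1 / p) β

/-- `y` is computed from `(I - β v vᵀ) b = b - (β (vᵀ b)) v`. -/
def FlApplyReflector (u : ℝ) {k : ℕ} (v : Fin k → ℝ) (β : ℝ) (b y : Fin k → ℝ) : Prop :=
  ∃ τ w, FlDot u (List.ofFn fun i => (v i, b i)) τ ∧ Rounds u (β * τ) w ∧
    ∀ i, ∃ p, Rounds u (w * v i) p ∧ Rounds u (b i - p) (y i)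

/-- `R` is the upper triangular factor computed by the Householder QR algorithm from a matrix `B`
with at least as many rows as columns. One step reduces the first column to `-σ e₀`, applies the
reflector to the other columns (the step is skipped when the column is zero), reads off the first
row of `R`, and the algorithm continues with the trailing submatrix. -/
def FlHouseholderQR (u : ℝ) : {s n : ℕ} → Matrix (Fin s) (Fin n) ℝ →
    Matrix (Fin n) (Fin n) ℝ → Prop
  | _, 0, _, _ => True
  | 0, _ + 1, _, _ => False
  | s + 1, n + 1, B, R =>
    ∃ (σ : ℝ) (C : Matrix (Fin (s + 1)) (Fin n) ℝ),
      FlSignedNorm u (fun i => B i 0) σ ∧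
      (σ = 0 → ∀ i j, C i j = B i j.succ) ∧
      (σ ≠ 0 → ∃ v β, FlHouseholderVector u (fun i => B i 0) σ v β ∧
        ∀ j : Fin n, FlApplyReflector u v β (fun i => B i j.succ) (fun i => C i j)) ∧
      R 0 0 = -σ ∧ (∀ j : Fin n, R 0 j.succ = C 0 j) ∧ (∀ i : Fin n, R i.succ 0 = 0) ∧
      FlHouseholderQR u (C.submatrix Fin.succ id) (R.submatrix Fin.succ Fin.succ)

/-! ### Constants -/

/-- `γ_k = k u / (1 - k u)`; `γ̃_{sn}` is `γ_{c s n}`. -/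
noncomputable def gam (u : ℝ) (k : ℕ) : ℝ := k * u / (1 - k * u)

/-- `C₁ = √(sn) γ_m + √n γ̃_{sn} (1 + √(sn) γ_m)`. -/
noncomputable def C₁ (c : ℕ) (u : ℝ) (m s n : ℕ) : ℝ :=
  Real.sqrt (s * n) * gam u m +
    Real.sqrt n * gam u (c * s * n) * (1 + Real.sqrt (s * n) * gam u m)

/-- `k(S) = ‖S‖₂ ‖(S Q_A)†‖₂`. -/
noncomputable def kS {m s n : ℕ} (S : Matrix (Fin s) (Fin m) ℝ) (QA : Matrix (Fin m) (Fin n) ℝ) :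
    ℝ :=
  ‖S‖ * ‖pinv (S * QA)‖

end SketchApply

open SketchApply

/-! The computed quantities are exact for nearby data: `(R + ΔR) x = z` by backward stability of
back substitution, and `z` solves exactly the least squares problem of `Y + ΔY`. Hence `x` is a
least squares solution for `(Y + ΔY) * (R + ΔR)`, and `ΔA` is the difference between this product
and `A`, namely `-(A - Y * R) + Y * ΔR + ΔY * (R + ΔR)`. It remains to bound `‖R‖` and `‖Y‖` and the
two substitution residuals.

The Householder analysis (`FlHouseholderQR.exists_gram_eq`) replaces `R` by a matrix with the same
Gram matrix, so that `‖R x‖ = ‖(S A + E) x‖` with `‖E‖ ≤ C₁ ‖S‖ ‖A‖` (`exists_sketch_perturbation`).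
The condition on `κ₂(A)` makes `E` harmless: `‖R‖` is at most `4/3 ‖S‖ ‖A‖`, and `‖A R⁻¹‖` is at
most `3/2 ‖(S Q_A)†‖` (`vnorm_mulVec_le_of_sketch`).

The condition on `m/n + √n` gives `200 n γ_n ≤ C₁` (`mul_gam_le_C₁`), so the same bound on `κ₂(A)`
also controls the substitution error relative to the conditioning of `R`, and `Y` is almost as small
as `A R⁻¹`. -/

namespace SketchApply

/-! ### Euclidean norm of coordinate vectors -/

/-- The Euclidean norm of a coordinate vector. -/
noncomputable def vnorm {n : ℕ} (v : Fin n → ℝ) : ℝ := ‖WithLp.toLp 2 v‖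

theorem vnorm_nonneg {n : ℕ} (v : Fin n → ℝ) : 0 ≤ vnorm v := norm_nonneg _

theorem vnorm_sq {n : ℕ} (v : Fin n → ℝ) : vnorm v ^ 2 = v ⬝ᵥ v := by
  simp only [vnorm, EuclideanSpace.norm_sq_eq, dotProduct, Real.norm_eq_abs, sq_abs]
  simp only [pow_two]

theorem vnorm_sq_eq_sum {n : ℕ} (v : Fin n → ℝ) : vnorm v ^ 2 = ∑ i, v i ^ 2 := by
  simp [vnorm, EuclideanSpace.norm_sq_eq]

theorem vnorm_eq_sqrt {n : ℕ} (v : Fin n → ℝ) : vnorm v = Real.sqrt (v ⬝ᵥ v) := by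
  rw [← vnorm_sq, Real.sqrt_sq (vnorm_nonneg v)]

theorem vnorm_add_le {n : ℕ} (v w : Fin n → ℝ) : vnorm (v + w) ≤ vnorm v + vnorm w := by
  simpa [vnorm] using norm_add_le (WithLp.toLp 2 v) (WithLp.toLp 2 w)

theorem vnorm_smul {n : ℕ} (a : ℝ) (v : Fin n → ℝ) : vnorm (a • v) = |a| * vnorm v := by
  simp [vnorm, norm_smul]

theorem vnorm_zero {n : ℕ} : vnorm (0 : Fin n → ℝ) = 0 := by simp [vnorm]

theorem vnorm_eq_zero {n : ℕ} {v : Fin n → ℝ} : vnorm v = 0 ↔ v = 0 := by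
  simp [vnorm]

theorem vnorm_mono {n : ℕ} {v w : Fin n → ℝ} (h : ∀ i, |v i| ≤ |w i|) : vnorm v ≤ vnorm w := by
  refine le_of_sq_le_sq ?_ (vnorm_nonneg w)
  rw [vnorm_sq_eq_sum, vnorm_sq_eq_sum]
  exact Finset.sum_le_sum fun i _ => sq_le_sq.mpr (h i)

theorem vnorm_abs {n : ℕ} (v : Fin n → ℝ) : vnorm |v| = vnorm v :=
  le_antisymm (vnorm_mono fun i => by simp) (vnorm_mono fun i => by simp)

theorem abs_dotProduct_le {n : ℕ} (v w : Fin n → ℝ) : |v ⬝ᵥ w| ≤ vnorm v * vnorm w := by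
  refine abs_le_of_sq_le_sq ?_ (mul_nonneg (vnorm_nonneg v) (vnorm_nonneg w))
  rw [mul_pow, vnorm_sq_eq_sum, vnorm_sq_eq_sum]
  exact Finset.sum_mul_sq_le_sq_mul_sq _ _ _

theorem vnorm_eq_of_dotProduct_eq {m n : ℕ} {v : Fin m → ℝ} {w : Fin n → ℝ}
    (h : v ⬝ᵥ v = w ⬝ᵥ w) : vnorm v = vnorm w := by
  rw [vnorm_eq_sqrt, vnorm_eq_sqrt, h]

/-! ### Spectral and Frobenius norms -/

theorem vnorm_mulVec_le {m n : ℕ} (M : Matrix (Fin m) (Fin n) ℝ) (x : Fin n → ℝ) :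
    vnorm (M *ᵥ x) ≤ ‖M‖ * vnorm x := by
  simpa [vnorm] using Matrix.l2_opNorm_mulVec M (WithLp.toLp 2 x)

theorem opNorm_le {m n : ℕ} {M : Matrix (Fin m) (Fin n) ℝ} {c : ℝ} (hc : 0 ≤ c)
    (h : ∀ x, vnorm (M *ᵥ x) ≤ c * vnorm x) : ‖M‖ ≤ c := by
  rw [Matrix.l2_opNorm_def]
  refine ContinuousLinearMap.opNorm_le_bound _ hc fun x => ?_
  exact h x.ofLp

theorem opNorm_transpose {m n : ℕ} (M : Matrix (Fin m) (Fin n) ℝ) : ‖Mᵀ‖ = ‖M‖ := by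
  rw [← Matrix.conjTranspose_eq_transpose_of_trivial, Matrix.l2_opNorm_conjTranspose]

/-- The square of the Frobenius norm. -/
noncomputable def frobSq {m n : ℕ} (M : Matrix (Fin m) (Fin n) ℝ) : ℝ := ∑ i, ∑ j, M i j ^ 2

theorem frobSq_nonneg {m n : ℕ} (M : Matrix (Fin m) (Fin n) ℝ) : 0 ≤ frobSq M :=
  Finset.sum_nonneg fun _ _ => Finset.sum_nonneg fun _ _ => sq_nonneg _

theorem frobSq_transpose {m n : ℕ} (M : Matrix (Fin m) (Fin n) ℝ) : frobSq Mᵀ = frobSq M :=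
  Finset.sum_comm

theorem frobSq_eq_sum_col {m n : ℕ} (M : Matrix (Fin m) (Fin n) ℝ) :
    frobSq M = ∑ j, vnorm (M.col j) ^ 2 := by
  simp only [vnorm_sq_eq_sum, Matrix.col_apply]
  exact Finset.sum_comm

theorem opNorm_sq_le_frobSq {m n : ℕ} (M : Matrix (Fin m) (Fin n) ℝ) : ‖M‖ ^ 2 ≤ frobSq M := by
  have h : ‖M‖ ≤ Real.sqrt (frobSq M) := by
    refine opNorm_le (Real.sqrt_nonneg _) fun x => ?_
    refine le_of_sq_le_sq ?_ (mul_nonneg (Real.sqrt_nonneg _) (vnorm_nonneg x))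
    rw [mul_pow, Real.sq_sqrt (frobSq_nonneg M), vnorm_sq_eq_sum, vnorm_sq_eq_sum, frobSq,
      Finset.sum_mul]
    exact Finset.sum_le_sum fun i _ => Finset.sum_mul_sq_le_sq_mul_sq Finset.univ (M i) x
  calc ‖M‖ ^ 2 ≤ Real.sqrt (frobSq M) ^ 2 := by gcongr
    _ = frobSq M := Real.sq_sqrt (frobSq_nonneg M)

theorem opNorm_le_of_frobSq_le {m n : ℕ} {M : Matrix (Fin m) (Fin n) ℝ} {c : ℝ} (hc : 0 ≤ c)
    (h : frobSq M ≤ c ^ 2) : ‖M‖ ≤ c :=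
  le_of_sq_le_sq ((opNorm_sq_le_frobSq M).trans h) hc

theorem vnorm_col_le {m n : ℕ} (M : Matrix (Fin m) (Fin n) ℝ) (j : Fin n) :
    vnorm (M.col j) ≤ ‖M‖ := by
  have h := vnorm_mulVec_le M (Pi.single j 1)
  have h1 : vnorm (Pi.single j 1 : Fin n → ℝ) = 1 := by
    rw [vnorm_eq_sqrt]; simp
  rwa [Matrix.mulVec_single_one, h1, mul_one] at h

theorem frobSq_le_col {m n : ℕ} (M : Matrix (Fin m) (Fin n) ℝ) : frobSq M ≤ n * ‖M‖ ^ 2 := by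
  rw [frobSq_eq_sum_col]
  calc ∑ j, vnorm (M.col j) ^ 2 ≤ ∑ _j : Fin n, ‖M‖ ^ 2 :=
        Finset.sum_le_sum fun j _ => pow_le_pow_left₀ (vnorm_nonneg _) (vnorm_col_le M j) 2
    _ = n * ‖M‖ ^ 2 := by simp

theorem frobSq_le_row {m n : ℕ} (M : Matrix (Fin m) (Fin n) ℝ) : frobSq M ≤ m * ‖M‖ ^ 2 := by
  rw [← frobSq_transpose, ← opNorm_transpose]
  exact frobSq_le_col Mᵀ

/-- Passage from componentwise to normwise bounds: Cauchy–Schwarz in each entry, and the Frobenius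
norm does not see the absolute values. -/
theorem frobSq_le_of_abs_le {m k n : ℕ} {F : Matrix (Fin m) (Fin n) ℝ}
    {X : Matrix (Fin m) (Fin k) ℝ} {Z : Matrix (Fin k) (Fin n) ℝ} {g : ℝ}
    (h : ∀ i j, |F i j| ≤ g * ∑ l, |X i l * Z l j|) :
    frobSq F ≤ g ^ 2 * (frobSq X * frobSq Z) := by
  rw [← frobSq_transpose Z, frobSq, frobSq, frobSq, Finset.sum_mul_sum, Finset.mul_sum]
  refine Finset.sum_le_sum fun i _ => ?_
  rw [Finset.mul_sum]
  refine Finset.sum_le_sum fun j _ => ?_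
  have h1 : F i j ^ 2 ≤ (g * ∑ l, |X i l * Z l j|) ^ 2 :=
    sq_le_sq.mpr ((h i j).trans (le_abs_self _))
  have h2 := Finset.sum_mul_sq_le_sq_mul_sq Finset.univ (fun l => |X i l|) (fun l => |Z l j|)
  simp only [sq_abs, ← abs_mul] at h2
  calc F i j ^ 2 ≤ g ^ 2 * (∑ l, |X i l * Z l j|) ^ 2 := by rw [← mul_pow]; exact h1
    _ ≤ _ := by gcongr; exact h2

/-! ### The pseudo-inverse -/

theorem pinv_mul_self {m n : ℕ} {M : Matrix (Fin m) (Fin n) ℝ}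
    (h : LinearIndependent ℝ M.col) : pinv M * M = 1 := by
  have hinj : Function.Injective M.mulVec := Matrix.mulVec_injective_iff.mpr h
  refine Matrix.ext_of_mulVec_single fun j => hinj ?_
  rw [Matrix.mulVec_mulVec, ← Matrix.mul_assoc, (pinv_spec M).mul_mul, Matrix.one_mulVec]

theorem vnorm_le_pinv {m n : ℕ} {M : Matrix (Fin m) (Fin n) ℝ}
    (h : LinearIndependent ℝ M.col) (x : Fin n → ℝ) :
    vnorm x ≤ ‖pinv M‖ * vnorm (M *ᵥ x) := by
  have := vnorm_mulVec_le (pinv M) (M *ᵥ x)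
  rwa [Matrix.mulVec_mulVec, pinv_mul_self h, Matrix.one_mulVec] at this

/-- Pythagoras: since `Mᵀ M M† = Mᵀ`, the residual is orthogonal to the range of `M`. No rank
condition enters, which matters because `Y + ΔY` may be rank deficient. -/
theorem isLeastSquaresSolution_pinv {m n : ℕ} (M : Matrix (Fin m) (Fin n) ℝ) (b : Fin m → ℝ) :
    IsLeastSquaresSolution M b (pinv M *ᵥ b) := by
  intro y
  set x := pinv M *ᵥ b with hx
  have horth : Mᵀ *ᵥ (M *ᵥ x - b) = 0 := by
    have h : Mᵀ * (M * pinv M) = Mᵀ := by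
      conv_lhs => rw [← (pinv_spec M).symm_left, ← Matrix.transpose_mul, (pinv_spec M).mul_mul]
    rw [Matrix.mulVec_sub, hx, Matrix.mulVec_mulVec, Matrix.mulVec_mulVec, Matrix.mul_assoc, h, sub_self]
  have hd : (M *ᵥ (y - x)) ⬝ᵥ (M *ᵥ x - b) = 0 := by
    rw [dotProduct_comm, Matrix.dotProduct_mulVec, ← Matrix.mulVec_transpose, horth,
      zero_dotProduct]
  have hs : M *ᵥ y - b = M *ᵥ (y - x) + (M *ᵥ x - b) := by
    rw [Matrix.mulVec_sub]; abel
  change vnorm _ ≤ vnorm _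
  refine le_of_sq_le_sq ?_ (vnorm_nonneg _)
  rw [vnorm_sq (M *ᵥ y - b), hs, add_dotProduct, dotProduct_add, dotProduct_add, hd,
    dotProduct_comm (M *ᵥ x - b), hd, ← vnorm_sq, ← vnorm_sq]
  nlinarith [sq_nonneg (vnorm (M *ᵥ (y - x)))]

/-! ### Rounding errors of elementary operations -/

theorem Rounds.abs_error_le {u x y : ℝ} (h : Rounds u x y) : |y - x| ≤ u * |x| := by
  obtain ⟨δ, hδ, rfl⟩ := h
  rw [show x * (1 + δ) - x = δ * x by ring, abs_mul]
  gcongr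

/-- Errors are measured against a bound `k` of `|x|`, not against `|x|` itself, so that cancellation
in inner products is harmless. -/
theorem Rounds.abs_sub_le_of_close {u e k x y z : ℝ} (h : Rounds u y z) (hu : 0 ≤ u)
    (hy : |y - x| ≤ e * k) (hx : |x| ≤ k) : |z - x| ≤ (e + u + e * u) * k := by
  have h1 := h.abs_error_le
  have h2 : |z - x| ≤ |z - y| + |y - x| := abs_sub_le z y x
  have h3 : |y| ≤ e * k + k := by
    have := abs_sub_abs_le_abs_sub y x
    linarith
  have h4 := mul_le_mul_of_nonneg_left h3 hu
  nlinarith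

theorem abs_mul_sub_mul_le {a a' b b' A B e f : ℝ} (ha : |a' - a| ≤ e * A) (hA : |a| ≤ A)
    (hb : |b' - b| ≤ f * B) (hB : |b| ≤ B) :
    |a' * b' - a * b| ≤ (e + f + e * f) * (A * B) := by
  have h0 : a' * b' - a * b = (a' - a) * (b' - b) + (a' - a) * b + a * (b' - b) := by ring
  have h1 : |(a' - a) * (b' - b)| ≤ (e * A) * (f * B) := by
    rw [abs_mul]; exact mul_le_mul ha hb (abs_nonneg _) ((abs_nonneg _).trans ha)
  have h2 : |(a' - a) * b| ≤ (e * A) * B := by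
    rw [abs_mul]; exact mul_le_mul ha hB (abs_nonneg _) ((abs_nonneg _).trans ha)
  have h3 : |a * (b' - b)| ≤ A * (f * B) := by
    rw [abs_mul]; exact mul_le_mul hA hb (abs_nonneg _) ((abs_nonneg _).trans hA)
  rw [h0]
  have := abs_add_three ((a' - a) * (b' - b)) ((a' - a) * b) (a * (b' - b))
  linarith

theorem gam_eq {u : ℝ} {k : ℕ} (h : k * u < 1) : gam u k = (1 - k * u)⁻¹ - 1 := by
  have : 1 - (k : ℝ) * u ≠ 0 := by linarith
  rw [gam]; field_simp; ring

/-- Bernoulli's inequality `1 - k u ≤ (1 - u) ^ k`, inverted. -/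
theorem inv_one_sub_pow_sub_one_le_gam {u : ℝ} {k : ℕ} (hu1 : u < 1)
    (h : k * u < 1) : ((1 - u)⁻¹) ^ k - 1 ≤ gam u k := by
  rw [gam_eq h, inv_pow]
  have h1 : 1 - k * u ≤ (1 - u) ^ k := by
    have := one_add_mul_le_pow (a := -u) (by linarith) k
    rw [← sub_eq_add_neg] at this
    linarith
  have := inv_anti₀ (by linarith) h1
  linarith

theorem one_add_le_inv_one_sub {u : ℝ} (hu1 : u < 1) : 1 + u ≤ (1 - u)⁻¹ := by
  rw [← one_div, le_div_iff₀ (by linarith)]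
  nlinarith [sq_nonneg u]

theorem one_add_pow_sub_one_le_gam {u : ℝ} {k : ℕ} (hu : 0 ≤ u) (hu1 : u < 1)
    (h : k * u < 1) : (1 + u) ^ k - 1 ≤ gam u k := by
  have h1 : (1 + u) ^ k ≤ ((1 - u)⁻¹) ^ k :=
    pow_le_pow_left₀ (by linarith) (one_add_le_inv_one_sub hu1) k
  have := inv_one_sub_pow_sub_one_le_gam hu1 h
  linarith

/-! ### Inner products and substitution -/

/-- The initial value undergoes only the additions; each product also suffers its own rounding,
whence the larger exponent. -/
theorem FlAddDot.abs_error_le {u : ℝ} (hu : 0 ≤ u) : ∀ {l : List (ℝ × ℝ)} {c r : ℝ},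
    FlAddDot u l c r → |r - (c + (l.map fun ab => ab.1 * ab.2).sum)| ≤
      ((1 + u) ^ l.length - 1) * |c| +
        ((1 + u) ^ (l.length + 1) - 1) * (l.map fun ab => |ab.1 * ab.2|).sum
  | [], c, r, h => by
    have : r = c := h
    simp [this]
  | ab :: l, c, r, ⟨p, c', hp, hc, h⟩ => by
    have ih := FlAddDot.abs_error_le hu h
    simp only [List.map_cons, List.sum_cons, List.length_cons]
    set T := (l.map fun ab => ab.1 * ab.2).sum
    set U := (l.map fun ab => |ab.1 * ab.2|).sum
    set q := ab.1 * ab.2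
    have hp1 := hp.abs_error_le
    have hc1 : |c' - (c + q)| ≤ u * |c| + (u + u + u * u) * |q| := by
      have h1 := hc.abs_error_le
      have h2 : |c + p| ≤ |c| + (|q| + u * |q|) := by
        have e1 := abs_add_le c p
        have e2 := abs_sub_abs_le_abs_sub p q
        linarith
      have h3 : |c' - (c + q)| ≤ |c' - (c + p)| + |p - q| := by
        have := abs_sub_le c' (c + p) (c + q)
        rwa [show c + p - (c + q) = p - q by ring] at this
      have := mul_le_mul_of_nonneg_left h2 hu
      linarith
    have hc2 : |c'| ≤ (1 + u) * |c| + (1 + u) ^ 2 * |q| := by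
      have e1 := abs_sub_abs_le_abs_sub c' (c + q)
      have e2 := abs_add_le c q
      nlinarith
    have hpow : 0 ≤ (1 + u) ^ l.length - 1 := by
      have := one_le_pow₀ (n := l.length) (show (1 : ℝ) ≤ 1 + u by linarith)
      linarith
    have hU : 0 ≤ U := List.sum_nonneg (by
      intro x hx; obtain ⟨_, _, rfl⟩ := List.mem_map.mp hx; exact abs_nonneg _)
    have h4 := mul_le_mul_of_nonneg_left hc2 hpow
    have h5 : |r - (c + (q + T))| ≤ |r - (c' + T)| + |c' - (c + q)| := by
      have := abs_sub_le r (c' + T) (c + (q + T))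
      rwa [show c' + T - (c + (q + T)) = c' - (c + q) by ring] at this
    have h6 : ((1 + u) ^ (l.length + 1) - 1) * U ≤ ((1 + u) ^ (l.length + 1 + 1) - 1) * U := by
      gcongr <;> linarith
    have e : ((1 + u) ^ (l.length + 1) - 1) * |c| + ((1 + u) ^ (l.length + 1 + 1) - 1) * (|q| + U)
        = u * |c| + (u + u + u * u) * |q| +
          ((1 + u) ^ l.length - 1) * ((1 + u) * |c| + (1 + u) ^ 2 * |q|) +
          ((1 + u) ^ (l.length + 1 + 1) - 1) * U := by ring
    rw [e]
    linarith

theorem FlDot.abs_error_le {u : ℝ} (hu : 0 ≤ u) {l : List (ℝ × ℝ)} {r : ℝ} (h : FlDot u l r) :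
    |r - (l.map fun ab => ab.1 * ab.2).sum| ≤
      ((1 + u) ^ l.length - 1) * (l.map fun ab => |ab.1 * ab.2|).sum := by
  cases l with
  | nil =>
    have : r = 0 := h
    simp [this]
  | cons ab l =>
    obtain ⟨p, hp, h⟩ := h
    have h1 := h.abs_error_le hu
    have hp1 := hp.abs_error_le
    simp only [List.map_cons, List.sum_cons, List.length_cons]
    set T := (l.map fun ab => ab.1 * ab.2).sum
    set U := (l.map fun ab => |ab.1 * ab.2|).sum
    set q := ab.1 * ab.2
    have hp2 : |p| ≤ (1 + u) * |q| := by
      have := abs_sub_abs_le_abs_sub p q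
      linarith
    have hpow : 0 ≤ (1 + u) ^ l.length - 1 := by
      have := one_le_pow₀ (n := l.length) (show (1 : ℝ) ≤ 1 + u by linarith)
      linarith
    have h2 := mul_le_mul_of_nonneg_left hp2 hpow
    have h3 : |r - (q + T)| ≤ |r - (p + T)| + |p - q| := by
      have := abs_sub_le r (p + T) (q + T)
      rwa [show p + T - (q + T) = p - q by ring] at this
    have e : ((1 + u) ^ (l.length + 1) - 1) * (|q| + U) = u * |q| +
        ((1 + u) ^ l.length - 1) * ((1 + u) * |q|) + ((1 + u) ^ (l.length + 1) - 1) * U := by ring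
    rw [e]
    linarith

theorem FlDot.abs_sub_dotProduct_le {u : ℝ} {k : ℕ} (hu : 0 ≤ u) (hu1 : u < 1) (hk : k * u < 1)
    {a b : Fin k → ℝ} {r : ℝ} (h : FlDot u (List.ofFn fun i => (a i, b i)) r) :
    |r - a ⬝ᵥ b| ≤ gam u k * ∑ i, |a i * b i| := by
  have h1 := h.abs_error_le hu
  simp only [List.map_ofFn, List.sum_ofFn, List.length_ofFn, Function.comp_def] at h1
  refine h1.trans (mul_le_mul_of_nonneg_right (one_add_pow_sub_one_le_gam hu hu1 hk) ?_)
  exact Finset.sum_nonneg fun _ _ => abs_nonneg _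

theorem FlMatMul.abs_error_le {u : ℝ} {m n p : ℕ} (hu : 0 ≤ u) (hu1 : u < 1) (hn : n * u < 1)
    {A : Matrix (Fin m) (Fin n) ℝ} {B : Matrix (Fin n) (Fin p) ℝ} {C : Matrix (Fin m) (Fin p) ℝ}
    (h : FlMatMul u A B C) (i : Fin m) (j : Fin p) :
    |(C - A * B) i j| ≤ gam u n * ∑ k, |A i k * B k j| :=
  (h i j).abs_sub_dotProduct_le hu hu1 hn

theorem abs_div_one_add_sub_le {u δ x k : ℝ} (hu1 : u < 1) (hδ : |δ| ≤ u) (hx : |x| ≤ k) :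
    |x / (1 + δ) - x| ≤ ((1 - u)⁻¹ - 1) * k := by
  have hδ' := abs_le.mp hδ
  have h1 : 0 < 1 + δ := by linarith
  have h2 : 0 < 1 - u := by linarith
  have h3 : x / (1 + δ) - x = (-δ / (1 + δ)) * x := by field_simp; ring
  rw [h3, abs_mul]
  have h4 : |-δ / (1 + δ)| ≤ (1 - u)⁻¹ - 1 := by
    rw [abs_div, abs_neg, abs_of_pos h1,
      show (1 - u)⁻¹ - 1 = u / (1 - u) by field_simp; ring]
    exact div_le_div₀ ((abs_nonneg _).trans hδ) hδ h2 (by linarith)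
  exact mul_le_mul h4 hx (abs_nonneg _) ((abs_nonneg _).trans h4)

theorem abs_sum_map_le {α : Type*} (l : List α) (f : α → ℝ) :
    |(l.map f).sum| ≤ (l.map fun a => |f a|).sum := by
  induction l with
  | nil => simp
  | cons a l ih =>
    simp only [List.map_cons, List.sum_cons]
    exact (abs_add_le _ _).trans (by linarith)

/-- The error is bounded by the output `t` and the products, not by the input `c`: each subtraction
is undone by dividing by `1 + δ`, which produces powers of `(1 - u)⁻¹`. This yields residual bounds
in terms of the computed unknowns. -/
theorem FlSubDot.abs_error_le {u : ℝ} (hu : 0 ≤ u) (hu1 : u < 1) : ∀ {l : List (ℝ × ℝ)} {c t : ℝ},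
    FlSubDot u l c t → |c - (t + (l.map fun ab => ab.1 * ab.2).sum)| ≤
      (((1 - u)⁻¹) ^ l.length - 1) * (|t| + (l.map fun ab => |ab.1 * ab.2|).sum)
  | [], c, t, h => by
    have : t = c := h
    simp [this]
  | ab :: l, c, t, ⟨p, c', hp, hc, h⟩ => by
    have ih := FlSubDot.abs_error_le hu hu1 h
    simp only [List.map_cons, List.sum_cons, List.length_cons]
    set T := (l.map fun ab => ab.1 * ab.2).sum
    set U := (l.map fun ab => |ab.1 * ab.2|).sum with hUdef
    set q := ab.1 * ab.2
    set w := (1 - u)⁻¹ with hw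
    have hw1 : 1 + u ≤ w := one_add_le_inv_one_sub hu1
    have hpw : 1 ≤ w ^ l.length := one_le_pow₀ (by linarith)
    have hTU : |T| ≤ U := by
      rw [hUdef]
      exact abs_sum_map_le l fun ab => ab.1 * ab.2
    have hU : 0 ≤ U := (abs_nonneg _).trans hTU
    have hp1 := hp.abs_error_le
    obtain ⟨δ, hδ, hc⟩ := hc
    have hδ' := abs_le.mp hδ
    have h1 : (1 + δ) ≠ 0 := by linarith
    have hcc : c - p = c' / (1 + δ) := by rw [hc]; field_simp
    have hc'b : |c'| ≤ (1 + (w ^ l.length - 1)) * (|t| + U) := by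
      have e1 := abs_sub_abs_le_abs_sub c' (t + T)
      have e2 := abs_add_le t T
      linarith
    have h2 := abs_div_one_add_sub_le hu1 hδ hc'b
    have e : c - (t + (q + T)) = (c' - (t + T)) + (c' / (1 + δ) - c') + (p - q) := by
      rw [← hcc]; ring
    rw [e]
    refine (abs_add_three _ _ _).trans ?_
    have h3 : u * |q| ≤ (w ^ (l.length + 1) - 1) * |q| := by
      gcongr
      have : w ≤ w ^ (l.length + 1) := by
        rw [pow_succ]; exact le_mul_of_one_le_left (by linarith) hpw
      linarith
    have e' : (w ^ (l.length + 1) - 1) * (|t| + (|q| + U)) = (w ^ l.length - 1) * (|t| + U) +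
        (w - 1) * ((1 + (w ^ l.length - 1)) * (|t| + U)) + (w ^ (l.length + 1) - 1) * |q| := by ring
    rw [e']
    linarith

/-- Residual of one computed unknown `y = (c - ∑ aᵢ bᵢ) / d`. -/
theorem FlSubDot.abs_residual_le {u : ℝ} {n : ℕ} (hu : 0 ≤ u) (hu1 : u < 1) (hn : n * u < 1)
    {l : List (ℝ × ℝ)} {c t d y : ℝ} (hl : l.length + 1 ≤ n) (hd : d ≠ 0)
    (h : FlSubDot u l c t) (hy : Rounds u (t / d) y) :
    |c - (d * y + (l.map fun ab => ab.1 * ab.2).sum)| ≤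
      gam u n * (|d * y| + (l.map fun ab => |ab.1 * ab.2|).sum) := by
  have h0 := h.abs_error_le hu hu1
  set T := (l.map fun ab => ab.1 * ab.2).sum
  set U := (l.map fun ab => |ab.1 * ab.2|).sum with hUdef
  have hU : 0 ≤ U := List.sum_nonneg (by
    intro x hx; obtain ⟨_, _, rfl⟩ := List.mem_map.mp hx; exact abs_nonneg _)
  obtain ⟨δ, hδ, hy⟩ := hy
  have hδ' := abs_le.mp hδ
  have h1 : (1 + δ) ≠ 0 := by linarith
  have ht : t = d * y / (1 + δ) := by rw [hy]; field_simp
  set w := (1 - u)⁻¹ with hw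
  have hw1 : 1 + u ≤ w := one_add_le_inv_one_sub hu1
  have hpw : 1 ≤ w ^ l.length := one_le_pow₀ (by linarith)
  have h2 := abs_div_one_add_sub_le (x := d * y) hu1 hδ le_rfl
  rw [← ht, ← hw] at h2
  have ht' : |t| ≤ w * |d * y| := by
    have := abs_sub_abs_le_abs_sub t (d * y)
    linarith
  have h3 := mul_le_mul_of_nonneg_left ht' (show 0 ≤ w ^ l.length - 1 by linarith)
  have hle : w ^ (l.length + 1) ≤ w ^ n := pow_le_pow_right₀ (by linarith) hl
  have hg := inv_one_sub_pow_sub_one_le_gam hu1 hn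
  have h4 : |c - (d * y + T)| ≤ |c - (t + T)| + |t - d * y| := by
    have := abs_sub_le c (t + T) (d * y + T)
    rwa [show t + T - (d * y + T) = t - d * y by ring] at this
  have h5 : (w ^ l.length - 1) * U ≤ (w ^ (l.length + 1) - 1) * U := by
    gcongr
    · linarith
    · omega
  calc |c - (d * y + T)| ≤ (w ^ (l.length + 1) - 1) * (|d * y| + U) := by
        have e : (w ^ (l.length + 1) - 1) * (|d * y| + U) = (w ^ l.length - 1) * (w * |d * y|) +
          (w - 1) * |d * y| + (w ^ (l.length + 1) - 1) * U := by ring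
        rw [e]; linarith
    _ ≤ gam u n * (|d * y| + U) := by gcongr; linarith

theorem sum_map_filter_finRange {n : ℕ} (p : Fin n → Prop) [DecidablePred p] (f : Fin n → ℝ) :
    (((List.finRange n).filter (fun k => decide (p k))).map f).sum =
      ∑ k with p k, f k := by
  rw [Finset.sum_filter, ← List.sum_ofFn, List.ofFn_eq_map]
  induction List.finRange n with
  | nil => simp
  | cons a l ih => by_cases h : p a <;> simp [h, ih]

theorem length_filter_finRange_lt {n : ℕ} (p : Fin n → Prop) [DecidablePred p] {j : Fin n}
    (hj : ¬ p j) : ((List.finRange n).filter (fun k => decide (p k))).length + 1 ≤ n := by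
  have h := List.length_filter_lt_length_iff_exists (l := List.finRange n)
    (p := fun k => decide (p k))
  have := h.mpr ⟨j, List.mem_finRange j, by simpa using hj⟩
  simpa using this

theorem FlForwardSub.abs_residual_le {u : ℝ} {n : ℕ} (hu : 0 ≤ u) (hu1 : u < 1) (hn : n * u < 1)
    {R : Matrix (Fin n) (Fin n) ℝ} (hup : ∀ i j, j < i → R i j = 0) (hd : ∀ i, R i i ≠ 0)
    {a y : Fin n → ℝ} (h : FlForwardSub u R a y) (j : Fin n) :
    |a j - ∑ k, y k * R k j| ≤ gam u n * ∑ k, |y k * R k j| := by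
  obtain ⟨t, h1, h2⟩ := h j
  -- The diagonal index is not among the subtracted terms, so there are at most `n - 1` of them; the
  -- division brings the count to at most `n`.
  have h3 := h1.abs_residual_le hu hu1 hn
    (by rw [List.length_map]; exact length_filter_finRange_lt (· < j) (lt_irrefl j)) (hd j) h2
  simp only [List.map_map, Function.comp_def] at h3
  rw [sum_map_filter_finRange (· < j), sum_map_filter_finRange (· < j)] at h3
  have key : ∀ f : Fin n → ℝ, (∀ k, R k j = 0 → f k = 0) →
      ∑ k, f k = f j + ∑ k with k < j, f k := by
    intro f hf
    rw [← Finset.sum_filter_add_sum_filter_not Finset.univ (· < j), add_comm]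
    congr 1
    refine Finset.sum_eq_single_of_mem j (by simp) fun k hk hkj => hf k (hup k j ?_)
    simp only [Finset.mem_filter, Finset.mem_univ, true_and, not_lt] at hk
    exact lt_of_le_of_ne hk (Ne.symm hkj)
  simp only [mul_comm (y _)]
  rw [key _ (by intro k hk; simp [hk]), key (fun k => |R k j * y k|) (by intro k hk; simp [hk])]
  exact h3

theorem FlBackSub.abs_residual_le {u : ℝ} {n : ℕ} (hu : 0 ≤ u) (hu1 : u < 1) (hn : n * u < 1)
    {R : Matrix (Fin n) (Fin n) ℝ} (hup : ∀ i j, j < i → R i j = 0) (hd : ∀ i, R i i ≠ 0)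
    {z x : Fin n → ℝ} (h : FlBackSub u R z x) (i : Fin n) :
    |z i - ∑ k, R i k * x k| ≤ gam u n * ∑ k, |R i k * x k| := by
  obtain ⟨t, h1, h2⟩ := h i
  have h3 := h1.abs_residual_le hu hu1 hn
    (by rw [List.length_map]; exact length_filter_finRange_lt (i < ·) (lt_irrefl i)) (hd i) h2
  simp only [List.map_map, Function.comp_def] at h3
  rw [sum_map_filter_finRange (i < ·), sum_map_filter_finRange (i < ·)] at h3
  have key : ∀ f : Fin n → ℝ, (∀ k, R i k = 0 → f k = 0) →
      ∑ k, f k = f i + ∑ k with i < k, f k := by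
    intro f hf
    rw [← Finset.sum_filter_add_sum_filter_not Finset.univ (i < ·), add_comm]
    congr 1
    refine Finset.sum_eq_single_of_mem i (by simp) fun k hk hki => hf k (hup i k ?_)
    simp only [Finset.mem_filter, Finset.mem_univ, true_and, not_lt] at hk
    exact lt_of_le_of_ne hk hki
  rw [key _ (by intro k hk; simp [hk]), key (fun k => |R i k * x k|) (by intro k hk; simp [hk])]
  exact h3

/-! ### Householder reflectors -/

/-- The vector `(I - β v vᵀ) b`. -/
def reflect {k : ℕ} (β : ℝ) (v b : Fin k → ℝ) : Fin k → ℝ := b - (β * (v ⬝ᵥ b)) • v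

theorem reflect_sub {k : ℕ} (β : ℝ) (v b c : Fin k → ℝ) :
    reflect β v (b - c) = reflect β v b - reflect β v c := by
  simp only [reflect, dotProduct_sub, mul_sub, sub_smul]
  abel

theorem reflect_dotProduct {k : ℕ} {β : ℝ} {v : Fin k → ℝ} (h : β * (v ⬝ᵥ v) = 2)
    (b c : Fin k → ℝ) : reflect β v b ⬝ᵥ reflect β v c = b ⬝ᵥ c := by
  simp only [reflect, dotProduct_sub, sub_dotProduct, dotProduct_smul, smul_dotProduct,
    smul_eq_mul, dotProduct_comm b v]
  linear_combination (β * (v ⬝ᵥ b) * (v ⬝ᵥ c)) * h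

theorem reflect_reflect {k : ℕ} {β : ℝ} {v : Fin k → ℝ} (h : β * (v ⬝ᵥ v) = 2)
    (b : Fin k → ℝ) : reflect β v (reflect β v b) = b := by
  ext i
  simp only [reflect, dotProduct_sub, dotProduct_smul, smul_eq_mul, Pi.sub_apply, Pi.smul_apply]
  linear_combination (β * (v ⬝ᵥ b) * v i) * h

theorem vnorm_reflect {k : ℕ} {β : ℝ} {v : Fin k → ℝ} (h : β * (v ⬝ᵥ v) = 2)
    (b : Fin k → ℝ) : vnorm (reflect β v b) = vnorm b :=
  vnorm_eq_of_dotProduct_eq (reflect_dotProduct h b b)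

/-- A reflector is an isometric involution, so forward and backward errors of a step have the same
norm. -/
theorem vnorm_reflect_sub {k : ℕ} {β : ℝ} {v : Fin k → ℝ} (h : β * (v ⬝ᵥ v) = 2)
    (b c : Fin k → ℝ) : vnorm (reflect β v b - c) = vnorm (b - reflect β v c) := by
  rw [← vnorm_reflect h (b - reflect β v c), reflect_sub, reflect_reflect h]

/-- The number `sign(x₀) ‖x‖₂`. -/
noncomputable def signedNorm {k : ℕ} (x : Fin (k + 1) → ℝ) : ℝ :=
  if 0 ≤ x 0 then vnorm x else -vnorm x

/-- The vector `x + sign(x₀) ‖x‖₂ e₀`. -/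
noncomputable def householderVec {k : ℕ} (x : Fin (k + 1) → ℝ) : Fin (k + 1) → ℝ :=
  x + Pi.single 0 (signedNorm x)

theorem householderVec_zero {k : ℕ} (x : Fin (k + 1) → ℝ) :
    householderVec x 0 = x 0 + signedNorm x := by simp [householderVec]

theorem householderVec_succ {k : ℕ} (x : Fin (k + 1) → ℝ) (i : Fin k) :
    householderVec x i.succ = x i.succ := by simp [householderVec]

theorem abs_signedNorm {k : ℕ} (x : Fin (k + 1) → ℝ) : |signedNorm x| = vnorm x := by
  unfold signedNorm
  split_ifs <;> simp [abs_of_nonneg (vnorm_nonneg x)]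

theorem signedNorm_sq {k : ℕ} (x : Fin (k + 1) → ℝ) : signedNorm x ^ 2 = x ⬝ᵥ x := by
  rw [← sq_abs, abs_signedNorm, vnorm_sq]

/-- The choice of sign prevents cancellation in the leading entry; an error relative to `‖x‖` is
therefore also small relative to that entry. -/
theorem vnorm_le_abs_householderVec {k : ℕ} (x : Fin (k + 1) → ℝ) :
    vnorm x ≤ |householderVec x 0| := by
  rw [householderVec_zero]
  have := vnorm_nonneg x
  unfold signedNorm
  split_ifs with h
  · exact le_trans (by linarith) (le_abs_self _)
  · exact le_trans (by linarith) (neg_le_abs _)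

theorem signedNorm_mul_pos {k : ℕ} {x : Fin (k + 1) → ℝ} (hx : 0 < vnorm x) :
    0 < signedNorm x * householderVec x 0 := by
  rw [householderVec_zero]
  unfold signedNorm
  split_ifs with h
  · positivity
  · exact mul_pos_of_neg_of_neg (by linarith) (by linarith)

theorem householderVec_dotProduct_self {k : ℕ} (x : Fin (k + 1) → ℝ) :
    householderVec x ⬝ᵥ householderVec x = 2 * (signedNorm x * householderVec x 0) := by
  rw [householderVec_zero]
  simp only [householderVec, dotProduct_add, add_dotProduct, dotProduct_single, single_dotProduct,
    Pi.add_apply, Pi.single_eq_same]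
  linear_combination -signedNorm_sq x

theorem householderVec_dotProduct {k : ℕ} (x : Fin (k + 1) → ℝ) :
    householderVec x ⬝ᵥ x = signedNorm x * householderVec x 0 := by
  rw [householderVec_zero]
  simp only [householderVec, add_dotProduct, single_dotProduct]
  linear_combination -signedNorm_sq x

theorem reflect_householderVec {k : ℕ} {x : Fin (k + 1) → ℝ} (hx : 0 < vnorm x) :
    reflect (1 / (signedNorm x * householderVec x 0)) (householderVec x) x =
      Pi.single 0 (-signedNorm x) := by
  have h := (signedNorm_mul_pos hx).ne'
  rw [reflect, householderVec_dotProduct, one_div_mul_cancel h, one_smul, householderVec,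
    Pi.single_neg]
  abel

/-! ### Rounding errors of one reflector -/

/-- Uses `1 / (1 - ε) ≤ 100 / 99 < 1.02`. -/
theorem gam_le_of_le {u ε : ℝ} {k : ℕ} (h : k * u ≤ ε) (hk : 0 ≤ k * u) (hε : ε ≤ 1 / 100) :
    gam u k ≤ 1.02 * ε := by
  rw [gam, div_le_iff₀ (by linarith)]
  nlinarith

theorem FlSignedNorm.abs_error_le {u ε : ℝ} {k : ℕ} (hu : 0 ≤ u) (hk : ((k + 1 : ℕ) : ℝ) * u ≤ ε)
    (hε : ε ≤ 1 / 100) {x : Fin (k + 1) → ℝ} {σ : ℝ} (h : FlSignedNorm u x σ) :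
    |σ - signedNorm x| ≤ 3 * ε * vnorm x := by
  obtain ⟨d, t, hd, ht, hσ⟩ := h
  have hku : 0 ≤ ((k + 1 : ℕ) : ℝ) * u := by positivity
  have hε0 : 0 ≤ ε := hku.trans hk
  have huε : u ≤ ε := by
    refine le_trans (le_mul_of_one_le_left hu ?_) hk
    simp
  have hN := vnorm_nonneg x
  have h1 : |d - vnorm x ^ 2| ≤ 1.02 * ε * vnorm x ^ 2 := by
    have h := hd.abs_sub_dotProduct_le hu (by linarith) (by linarith)
    simp only [abs_mul_self] at h
    rw [vnorm_sq]
    refine h.trans (mul_le_mul_of_nonneg_right (gam_le_of_le hk hku hε) ?_)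
    exact Finset.sum_nonneg fun _ _ => mul_self_nonneg _
  obtain ⟨h2, h3⟩ := abs_le.mp h1
  have hN2 := sq_nonneg (vnorm x)
  have h4 : |Real.sqrt d - vnorm x| ≤ 1.02 * ε * vnorm x := by
    rw [abs_le]
    -- With `a = 1.02 ε`, the squared norm has relative error `a`, and `(1 - a)² ≤ 1 - a`, `1 + a ≤
    -- (1 + a)²`: the square root does not enlarge the relative error.
    constructor
    · have : (1 - 1.02 * ε) * vnorm x ≤ Real.sqrt d := by
        refine Real.le_sqrt_of_sq_le ?_
        have : (1 - 1.02 * ε) ^ 2 ≤ 1 - 1.02 * ε := by nlinarith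
        rw [mul_pow]
        nlinarith
      linarith
    · have : Real.sqrt d ≤ (1 + 1.02 * ε) * vnorm x := by
        refine Real.sqrt_le_iff.mpr ⟨by positivity, ?_⟩
        have : 1 + 1.02 * ε ≤ (1 + 1.02 * ε) ^ 2 := by nlinarith
        rw [mul_pow]
        nlinarith
      linarith
  have h5 := ht.abs_sub_le_of_close hu h4 (le_of_eq (abs_of_nonneg hN))
  have h6 : |t - vnorm x| ≤ 3 * ε * vnorm x := by
    refine h5.trans (mul_le_mul_of_nonneg_right ?_ hN)
    nlinarith
  rw [hσ, signedNorm]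
  split_ifs
  · exact h6
  · rwa [neg_sub_neg, abs_sub_comm]

/-- The constants are running totals, rounded up to absorb terms of order `ε²`: `3 + 1` becomes `5`
for the leading entry, `3 + 5 + 1` becomes `10` for `p`, inversion costs a factor `1 / 0.9`, and the
last rounding leads to `13`. -/
theorem FlHouseholderVector.abs_error_le {u ε : ℝ} {k : ℕ} (hu : 0 ≤ u) (huε : u ≤ ε)
    (hε : ε ≤ 1 / 100) {x v : Fin (k + 1) → ℝ} {σ β : ℝ} (hx : 0 < vnorm x)
    (hσ : |σ - signedNorm x| ≤ 3 * ε * vnorm x) (h : FlHouseholderVector u x σ v β) :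
    (∀ i, |v i - householderVec x i| ≤ 5 * ε * |householderVec x i|) ∧
      |β - 1 / (signedNorm x * householderVec x 0)| ≤
        13 * ε * (1 / (signedNorm x * householderVec x 0)) := by
  obtain ⟨h0, hs, p, hp, hβ⟩ := h
  have hε0 : 0 ≤ ε := hu.trans huε
  have hεε : ε * ε ≤ ε / 100 := by nlinarith
  have hεu : ε * u ≤ ε / 100 := by nlinarith
  have hq := signedNorm_mul_pos hx
  set V := householderVec x 0 with hV
  have hNV := vnorm_le_abs_householderVec x
  rw [← hV] at hNV
  have hv0 : |v 0 - V| ≤ 5 * ε * |V| := by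
    have h1 : |(x 0 + σ) - V| ≤ 3 * ε * |V| := by
      rw [hV, householderVec_zero, add_sub_add_left_eq_sub, ← householderVec_zero]
      exact hσ.trans (mul_le_mul_of_nonneg_left hNV (by positivity))
    refine (h0.abs_sub_le_of_close hu h1 le_rfl).trans
      (mul_le_mul_of_nonneg_right ?_ (abs_nonneg _))
    nlinarith
  refine ⟨fun i => ?_, ?_⟩
  · refine Fin.cases hv0 (fun i => ?_) i
    rw [hs, householderVec_succ, sub_self, abs_zero]
    positivity
  · set q := signedNorm x * V with hqdef
    have hpq : |p - q| ≤ 10 * ε * q := by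
      have h1 := abs_mul_sub_mul_le hσ (abs_signedNorm x).le hv0 le_rfl
      have hq' : vnorm x * |V| = q := by
        rw [← abs_signedNorm, ← abs_mul, abs_of_pos hq]
      rw [hq', ← hqdef] at h1
      refine (hp.abs_sub_le_of_close hu h1 (abs_of_pos hq).le).trans
        (mul_le_mul_of_nonneg_right ?_ hq.le)
      nlinarith
    have hpq' := (abs_le.mp hpq).1
    have hp0 : 9 / 10 * q ≤ p := by nlinarith
    have hppos : 0 < p := by linarith
    have h1 : |1 / p - 1 / q| ≤ 11.2 * ε * (1 / q) := by
      rw [show 1 / p - 1 / q = (q - p) / (p * q) by field_simp, abs_div, abs_sub_comm,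
        abs_of_pos (mul_pos hppos hq), div_le_iff₀ (mul_pos hppos hq)]
      rw [show 11.2 * ε * (1 / q) * (p * q) = 11.2 * ε * p by field_simp]
      nlinarith
    refine (hβ.abs_sub_le_of_close hu h1 (abs_of_pos (by positivity)).le).trans
        (mul_le_mul_of_nonneg_right ?_ (by positivity))
    nlinarith

/-- Entrywise the error is at most `ε |b| + 34 ε K |v|` with `K = β ∑ |vᵢ bᵢ|`. Cauchy–Schwarz and
`β vᵀ v = 2` give `K ‖v‖ ≤ 2 ‖b‖`, hence `69 = 1 + 2 · 34`. -/
theorem FlApplyReflector.vnorm_sub_le {u ε : ℝ} {k : ℕ} (hu : 0 ≤ u) (huε : u ≤ ε)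
    (hk : (k : ℝ) * u ≤ ε) (hε : ε ≤ 1 / 100) {v v' b y : Fin k → ℝ} {β β' : ℝ}
    (hv : ∀ i, |v' i - v i| ≤ 5 * ε * |v i|) (hβ0 : 0 ≤ β) (hβ : |β' - β| ≤ 13 * ε * β)
    (hvv : β * (v ⬝ᵥ v) = 2) (h : FlApplyReflector u v' β' b y) :
    vnorm (y - reflect β v b) ≤ 69 * ε * vnorm b := by
  obtain ⟨τ, w, hτ, hw, hy⟩ := h
  have hε0 : 0 ≤ ε := hu.trans huε
  have hεε : ε * ε ≤ ε / 100 := by nlinarith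
  have hεu : ε * u ≤ ε / 100 := by nlinarith
  set W := ∑ i, |v i * b i| with hW
  have hW0 : 0 ≤ W := Finset.sum_nonneg fun _ _ => abs_nonneg _
  have hWle : W ≤ vnorm v * vnorm b := by
    have h1 := abs_dotProduct_le |v| |b|
    rw [vnorm_abs, vnorm_abs] at h1
    refine le_trans (le_of_eq ?_) ((le_abs_self _).trans h1)
    simp [hW, dotProduct, abs_mul]
  have hvb : |v ⬝ᵥ b| ≤ W := Finset.abs_sum_le_sum_abs _ _
  have hτ1 : |τ - v ⬝ᵥ b| ≤ 7 * ε * W := by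
    have h1 := hτ.abs_sub_dotProduct_le hu (by linarith) (by linarith)
    have h2 : ∑ i, |v' i * b i| ≤ (1 + 5 * ε) * W := by
      rw [hW, Finset.mul_sum]
      refine Finset.sum_le_sum fun i _ => ?_
      have e := abs_sub_abs_le_abs_sub (v' i) (v i)
      have e' : |v' i| ≤ (1 + 5 * ε) * |v i| := by linarith [hv i]
      rw [abs_mul, abs_mul, ← mul_assoc]
      gcongr
    have h3 : |v' ⬝ᵥ b - v ⬝ᵥ b| ≤ 5 * ε * W := by
      rw [← sub_dotProduct, hW, Finset.mul_sum]
      refine (Finset.abs_sum_le_sum_abs _ _).trans (Finset.sum_le_sum fun i _ => ?_)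
      rw [Pi.sub_apply, abs_mul, abs_mul, ← mul_assoc]
      exact mul_le_mul_of_nonneg_right (hv i) (abs_nonneg _)
    have h4 : gam u k * ∑ i, |v' i * b i| ≤ (1.02 * ε) * ((1 + 5 * ε) * W) :=
      mul_le_mul (gam_le_of_le hk (by positivity) hε) h2
        (Finset.sum_nonneg fun _ _ => abs_nonneg _) (by positivity)
    have h5 : (1.02 * ε) * ((1 + 5 * ε) * W) ≤ 2 * ε * W := by
      rw [← mul_assoc]
      refine mul_le_mul_of_nonneg_right ?_ hW0
      nlinarith
    have := abs_sub_le τ (v' ⬝ᵥ b) (v ⬝ᵥ b)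
    linarith
  set K := β * W with hK
  have hK0 : 0 ≤ K := mul_nonneg hβ0 hW0
  set ω := β * (v ⬝ᵥ b) with hω
  have hωK : |ω| ≤ K := by
    rw [hω, abs_mul, abs_of_nonneg hβ0]
    exact mul_le_mul_of_nonneg_left hvb hβ0
  have hw1 : |w - ω| ≤ 23 * ε * K := by
    have h1 := abs_mul_sub_mul_le hβ (abs_of_nonneg hβ0).le hτ1 hvb
    have h2 : |β' * τ - ω| ≤ 21 * ε * K := by
      refine h1.trans (mul_le_mul_of_nonneg_right ?_ hK0)
      nlinarith
    refine (hw.abs_sub_le_of_close hu h2 hωK).trans (mul_le_mul_of_nonneg_right ?_ hK0)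
    nlinarith
  have hyi : ∀ i, |(y - reflect β v b) i| ≤ |(ε • |b| + (34 * ε * K) • |v|) i| := by
    intro i
    obtain ⟨p, hp, hyp⟩ := hy i
    have h1 := abs_mul_sub_mul_le hw1 hωK (hv i) le_rfl
    have hKv : 0 ≤ K * |v i| := mul_nonneg hK0 (abs_nonneg _)
    have h2 : |w * v' i - ω * v i| ≤ 30 * ε * (K * |v i|) := by
      refine h1.trans (mul_le_mul_of_nonneg_right ?_ hKv)
      nlinarith
    have hωv : |ω * v i| ≤ K * |v i| := by
      rw [abs_mul]; exact mul_le_mul_of_nonneg_right hωK (abs_nonneg _)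
    have h3 : |p - ω * v i| ≤ 32 * ε * (K * |v i|) := by
      refine (hp.abs_sub_le_of_close hu h2 hωv).trans (mul_le_mul_of_nonneg_right ?_ hKv)
      nlinarith
    have h4 := hyp.abs_error_le
    have h5 : |b i - p| ≤ |b i| + (1 + 32 * ε) * (K * |v i|) := by
      have e1 := abs_sub (b i) p
      have e2 := abs_sub_abs_le_abs_sub p (ω * v i)
      linarith
    have h6 : u * |b i - p| ≤ ε * (|b i| + (1 + 32 * ε) * (K * |v i|)) :=
      mul_le_mul huε h5 (abs_nonneg _) hε0
    have h7 : |y i - (b i - ω * v i)| ≤ |y i - (b i - p)| + |p - ω * v i| := by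
      have := abs_sub_le (y i) (b i - p) (b i - ω * v i)
      rwa [show b i - p - (b i - ω * v i) = -(p - ω * v i) by ring, abs_neg] at this
    have h8 : (ε * (1 + 32 * ε) + 32 * ε) * (K * |v i|) ≤ 34 * ε * (K * |v i|) := by
      refine mul_le_mul_of_nonneg_right ?_ hKv
      nlinarith
    refine le_trans ?_ (le_abs_self _)
    simp only [reflect, Pi.sub_apply, Pi.add_apply, Pi.smul_apply, Pi.abs_apply, smul_eq_mul,
      ← hω]
    nlinarith
  have hn : vnorm (y - reflect β v b) ≤ ε * vnorm b + 34 * ε * K * vnorm v := by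
    refine (vnorm_mono hyi).trans ((vnorm_add_le _ _).trans (le_of_eq ?_))
    rw [vnorm_smul, vnorm_smul, vnorm_abs, vnorm_abs, abs_of_nonneg hε0,
      abs_of_nonneg (by positivity : 0 ≤ 34 * ε * K)]
  have hKv : K * vnorm v ≤ 2 * vnorm b := by
    rw [← hvv, ← vnorm_sq, hK]
    have := mul_le_mul_of_nonneg_left hWle (mul_nonneg hβ0 (vnorm_nonneg v))
    nlinarith
  have := mul_le_mul_of_nonneg_left hKv (by positivity : 0 ≤ 34 * ε)
  nlinarith

/-! ### The Householder QR algorithm -/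

/-- One step of the Householder QR algorithm is a small perturbation of an orthogonal map. -/
theorem exists_isometry_of_householder_step {u ε : ℝ} {s n : ℕ} (hu : 0 ≤ u)
    (hs : ((s + 1 : ℕ) : ℝ) * u ≤ ε) (hε : ε ≤ 1 / 100)
    {x : Fin (s + 1) → ℝ} {B C : Fin n → Fin (s + 1) → ℝ} {σ : ℝ} (hσ : FlSignedNorm u x σ)
    (h0 : σ = 0 → ∀ j, C j = B j)
    (h1 : σ ≠ 0 → ∃ v β, FlHouseholderVector u x σ v β ∧
      ∀ j, FlApplyReflector u v β (B j) (C j)) :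
    ∃ P : (Fin (s + 1) → ℝ) → Fin (s + 1) → ℝ, (∀ b c, P (b - c) = P b - P c) ∧
      (∀ b c, P b ⬝ᵥ P c = b ⬝ᵥ c) ∧ vnorm (P (Pi.single 0 (-σ)) - x) ≤ 69 * ε * vnorm x ∧
      ∀ j, vnorm (P (C j) - B j) ≤ 69 * ε * vnorm (B j) := by
  have hε0 : 0 ≤ ε := le_trans (by positivity) hs
  have huε : u ≤ ε := by
    refine le_trans (le_mul_of_one_le_left hu ?_) hs
    simp
  have hσ1 := hσ.abs_error_le hu hs hε
  have hN := vnorm_nonneg x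
  -- The error of `σ` is at most `3 ε ‖x‖` with `3 ε < 1`, so `σ = 0` forces `x = 0`; the skipped
  -- step is then exact and the isometry is the identity.
  by_cases hσ0 : σ = 0
  · have hx : vnorm x = 0 := by
      rw [hσ0, zero_sub, abs_neg, abs_signedNorm] at hσ1
      nlinarith
    refine ⟨id, fun _ _ => rfl, fun _ _ => rfl, ?_, fun j => ?_⟩
    · rw [vnorm_eq_zero.mp hx, hσ0]
      simp [vnorm_zero]
    · rw [h0 hσ0 j, id, sub_self, vnorm_zero]
      have := vnorm_nonneg (B j)
      positivity
  · obtain ⟨v, β, hv, hy⟩ := h1 hσ0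
    have hx : 0 < vnorm x := by
      refine lt_of_le_of_ne hN fun h => hσ0 ?_
      have e := abs_signedNorm x
      rw [← h] at e hσ1
      rw [abs_eq_zero.mp e, sub_zero, mul_zero] at hσ1
      exact abs_eq_zero.mp (le_antisymm hσ1 (abs_nonneg _))
    obtain ⟨hv1, hβ1⟩ := hv.abs_error_le hu huε hε hx hσ1
    have hq := signedNorm_mul_pos hx
    have hvv : 1 / (signedNorm x * householderVec x 0) *
        (householderVec x ⬝ᵥ householderVec x) = 2 := by
      rw [householderVec_dotProduct_self, mul_left_comm, one_div_mul_cancel hq.ne', mul_one]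
    refine ⟨reflect (1 / (signedNorm x * householderVec x 0)) (householderVec x),
      reflect_sub _ _, reflect_dotProduct hvv, ?_, fun j => ?_⟩
    · rw [vnorm_reflect_sub hvv, reflect_householderVec hx, ← Pi.single_sub]
      have e : vnorm (Pi.single 0 (-σ - -signedNorm x) : Fin (s + 1) → ℝ) =
          |σ - signedNorm x| := by
        rw [vnorm_eq_sqrt, single_dotProduct, Pi.single_eq_same, Real.sqrt_mul_self_eq_abs,
          neg_sub_neg, abs_sub_comm]
      rw [e]
      refine hσ1.trans ?_
      gcongr
      norm_num
    · rw [vnorm_reflect_sub hvv]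
      exact (hy j).vnorm_sub_le hu huε hs hε hv1 (by positivity) hβ1 hvv

theorem FlHouseholderQR.upper {u : ℝ} {n : ℕ} : ∀ {s : ℕ} {B : Matrix (Fin s) (Fin n) ℝ}
    {R : Matrix (Fin n) (Fin n) ℝ}, FlHouseholderQR u B R → ∀ i j, j < i → R i j = 0 := by
  induction n with
  | zero => intro s B R _ i; exact i.elim0
  | succ n ih =>
    intro s B R h i j hij
    cases s with
    | zero => exact absurd h (by simp [FlHouseholderQR])
    | succ s =>
      rw [FlHouseholderQR] at h
      obtain ⟨σ, C, _, _, _, _, _, hcol, hrec⟩ := h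
      induction i using Fin.cases with
      | zero => exact absurd hij (Fin.not_lt_zero j)
      | succ i =>
        induction j using Fin.cases with
        | zero => exact hcol i
        | succ j => exact ih hrec i j (Fin.succ_lt_succ_iff.mp hij)

/-- The computed factor has the Gram matrix of a small columnwise perturbation of `B`. -/
theorem FlHouseholderQR.exists_gram_eq {u ε : ℝ} (hu : 0 ≤ u) (hε0 : 0 ≤ ε) (hε : ε ≤ 1 / 100)
    {n : ℕ} : ∀ {s : ℕ} {B : Matrix (Fin s) (Fin n) ℝ} {R : Matrix (Fin n) (Fin n) ℝ},
    (s : ℝ) * u ≤ ε → FlHouseholderQR u B R →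
    ∃ D : Fin n → Fin s → ℝ, (∀ j k, D j ⬝ᵥ D k = R.col j ⬝ᵥ R.col k) ∧
      ∀ j, vnorm (D j - B.col j) ≤ ((1 + 69 * ε) ^ n - 1) * vnorm (B.col j) := by
  induction n with
  | zero => exact fun _ _ => ⟨fun j => j.elim0, fun j => j.elim0, fun j => j.elim0⟩
  | succ n ih =>
    intro s B R hs h
    cases s with
    | zero => exact absurd h (by simp [FlHouseholderQR])
    | succ s =>
      rw [FlHouseholderQR] at h
      obtain ⟨σ, C, hσ, h0, h1, hR00, hR0, hRcol, hrec⟩ := h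
      obtain ⟨P, hPsub, hPdot, hPx, hPB⟩ := exists_isometry_of_householder_step
        (B := fun j => B.col j.succ) (C := C.col) hu hs hε hσ (fun h j => funext fun i => h0 h i j)
        h1
      have hPn : ∀ b, vnorm (P b) = vnorm b := fun b => vnorm_eq_of_dotProduct_eq (hPdot b b)
      have hs' : (s : ℝ) * u ≤ ε := by push_cast at hs; linarith
      obtain ⟨D, hD, hDB⟩ := ih hs' hrec
      have hE : 1 ≤ (1 + 69 * ε) ^ n := one_le_pow₀ (by linarith)
      -- Put the first row of `R` on top of the columns that represent the trailing factor, and pull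
      -- everything back by `P`. Inner products are preserved, so no orthogonal factor has to be
      -- accumulated.
      refine ⟨Fin.cons (P (Pi.single 0 (-σ))) fun j => P (Fin.cons (C 0 j) (D j)), ?_, ?_⟩
      · have hdot : ∀ j k, R.col j ⬝ᵥ R.col k =
            R 0 j * R 0 k + ∑ i : Fin n, R i.succ j * R i.succ k := by
          intro j k
          rw [dotProduct, Fin.sum_univ_succ]
          rfl
        intro j k
        rw [hdot]
        induction j using Fin.cases with
        | zero =>
          induction k using Fin.cases with
          | zero => simp [hPdot, hRcol, hR00]
          | succ k => simp [hPdot, hRcol, hR00, hR0]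
        | succ j =>
          induction k using Fin.cases with
          | zero => simp [hPdot, hRcol, hR00, hR0]
          | succ k =>
            have := hD j k
            simp only [dotProduct, Matrix.col_apply, Matrix.submatrix_apply] at this
            rw [← this, Fin.cons_succ, Fin.cons_succ, hPdot]
            simp [hR0, dotProduct, Fin.sum_univ_succ]
      · intro j
        induction j using Fin.cases with
        | zero =>
          simp only [Fin.cons_zero]
          refine hPx.trans (mul_le_mul_of_nonneg_right ?_ (vnorm_nonneg _))
          rw [pow_succ]
          nlinarith
        | succ j =>
          simp only [Fin.cons_succ]
          -- The two vectors inside `P` agree in the top entry, so only the trailing error survives.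
          have e1 : vnorm (P (Fin.cons (C 0 j) (D j)) - P (C.col j)) =
              vnorm (D j - (C.submatrix Fin.succ id).col j) := by
            rw [← hPsub, hPn]
            refine vnorm_eq_of_dotProduct_eq ?_
            simp [dotProduct, Fin.sum_univ_succ]
          have e2 : vnorm ((C.submatrix Fin.succ id).col j) ≤ vnorm (C.col j) := by
            refine le_of_sq_le_sq ?_ (vnorm_nonneg _)
            rw [vnorm_sq_eq_sum, vnorm_sq_eq_sum, Fin.sum_univ_succ]
            exact le_add_of_nonneg_left (sq_nonneg _)
          have e3 : vnorm (C.col j) ≤ (1 + 69 * ε) * vnorm (B.col j.succ) := by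
            have := vnorm_add_le (P (C.col j) - B.col j.succ) (B.col j.succ)
            rw [sub_add_cancel, hPn] at this
            linarith [hPB j]
          have e4 := vnorm_add_le (P (Fin.cons (C 0 j) (D j)) - P (C.col j))
            (P (C.col j) - B.col j.succ)
          rw [sub_add_sub_cancel, e1] at e4
          have e5 := mul_le_mul_of_nonneg_left (e2.trans e3)
            (show 0 ≤ (1 + 69 * ε) ^ n - 1 by linarith)
          rw [pow_succ]
          linarith [hPB j, hDB j]

/-! ### The sketched triangular factor -/

theorem vnorm_mulVec_eq_of_gram_eq {s m n : ℕ} {D : Matrix (Fin s) (Fin n) ℝ}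
    {R : Matrix (Fin m) (Fin n) ℝ} (h : Dᵀ * D = Rᵀ * R) (x : Fin n → ℝ) :
    vnorm (D *ᵥ x) = vnorm (R *ᵥ x) := by
  refine vnorm_eq_of_dotProduct_eq ?_
  rw [Matrix.dotProduct_mulVec, ← Matrix.mulVec_transpose, Matrix.mulVec_mulVec, h,
    Matrix.dotProduct_mulVec (R *ᵥ x), ← Matrix.mulVec_transpose, Matrix.mulVec_mulVec]

theorem gam_nonneg {u : ℝ} {k : ℕ} (hu : 0 ≤ u) (h : k * u < 1) : 0 ≤ gam u k :=
  div_nonneg (by positivity) (by linarith)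

theorem div_one_sub_mono {a b : ℝ} (ha : 0 ≤ a) (hab : a ≤ b) (hb : b < 1) :
    a / (1 - a) ≤ b / (1 - b) :=
  div_le_div₀ (ha.trans hab) hab (by linarith) (by linarith)

/-- Using the `s` rows of `S` and the `n` columns of `A` to pass from Frobenius to spectral norms
gives the factor `√(sn)`, free of `m`. -/
theorem FlMatMul.norm_sub_le {u : ℝ} {s m n : ℕ} (hu : 0 ≤ u) (hu1 : u < 1) (hm : m * u < 1)
    {S : Matrix (Fin s) (Fin m) ℝ} {A : Matrix (Fin m) (Fin n) ℝ} {B : Matrix (Fin s) (Fin n) ℝ}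
    (h : FlMatMul u S A B) : ‖B - S * A‖ ≤ Real.sqrt (s * n) * gam u m * (‖S‖ * ‖A‖) := by
  have hg := gam_nonneg hu hm
  refine opNorm_le_of_frobSq_le (by positivity) ?_
  refine (frobSq_le_of_abs_le (h.abs_error_le hu hu1 hm)).trans ?_
  have h1 : frobSq S * frobSq A ≤ (s * ‖S‖ ^ 2) * (n * ‖A‖ ^ 2) :=
    mul_le_mul (frobSq_le_row S) (frobSq_le_col A) (frobSq_nonneg A) (by positivity)
  rw [mul_pow, mul_pow, Real.sq_sqrt (by positivity)]
  calc _ ≤ gam u m ^ 2 * ((s * ‖S‖ ^ 2) * (n * ‖A‖ ^ 2)) := by gcongr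
    _ = _ := by ring

theorem FlHouseholderQR.exists_gram_eq_norm_sub_le {u : ℝ} {s n : ℕ} (hu : 0 ≤ u) (hn : 0 < n)
    (hs : ((100 * s * n : ℕ) : ℝ) * u < 1) {B : Matrix (Fin s) (Fin n) ℝ}
    {R : Matrix (Fin n) (Fin n) ℝ} (h : FlHouseholderQR u B R) :
    ∃ D : Matrix (Fin s) (Fin n) ℝ, Dᵀ * D = Rᵀ * R ∧
      ‖D - B‖ ≤ Real.sqrt n * gam u (100 * s * n) * ‖B‖ := by
  have hg := gam_nonneg hu hs
  push_cast at hs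
  have hn1 : (1 : ℝ) ≤ n := by exact_mod_cast hn
  have hsu : 0 ≤ (s : ℝ) * u := by positivity
  have hsun : (s : ℝ) * u ≤ n * (s * u) := le_mul_of_one_le_left hsu hn1
  -- The constant `100` serves twice: it makes `s u ≤ 1/100`, and it dominates the `69` of a single
  -- step.
  obtain ⟨D, hD, hDB⟩ := h.exists_gram_eq (ε := s * u) hu hsu (by linarith) le_rfl
  have hγ : (1 + 69 * (s * u)) ^ n - 1 ≤ gam u (100 * s * n) := by
    refine (one_add_pow_sub_one_le_gam (by positivity) (by linarith) (by linarith)).trans ?_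
    have := div_one_sub_mono (a := n * (69 * (s * u))) (b := 100 * s * n * u) (by positivity)
      (by nlinarith) hs
    rw [gam, gam]
    push_cast
    exact this
  refine ⟨Matrix.of fun i j => D j i, ?_, ?_⟩
  · ext j k
    exact hD j k
  · refine opNorm_le_of_frobSq_le (by positivity) ?_
    rw [frobSq_eq_sum_col]
    calc ∑ j, vnorm ((Matrix.of (fun i j => D j i) - B).col j) ^ 2
        ≤ ∑ j, gam u (100 * s * n) ^ 2 * vnorm (B.col j) ^ 2 := by
          refine Finset.sum_le_sum fun j _ => ?_
          rw [← mul_pow]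
          refine pow_le_pow_left₀ (vnorm_nonneg _) ?_ 2
          exact (hDB j).trans (mul_le_mul_of_nonneg_right hγ (vnorm_nonneg _))
      _ = gam u (100 * s * n) ^ 2 * frobSq B := by rw [← Finset.mul_sum, frobSq_eq_sum_col]
      _ ≤ gam u (100 * s * n) ^ 2 * (n * ‖B‖ ^ 2) := by gcongr; exact frobSq_le_col B
      _ = _ := by rw [mul_pow, mul_pow, Real.sq_sqrt (by positivity)]; ring

/-- The computed triangular factor of the sketch is the exact one of a nearby matrix, up to an
orthogonal factor. -/
theorem exists_sketch_perturbation {u : ℝ} {m s n : ℕ} (hu : 0 ≤ u) (hu1 : u < 1)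
    (hm : m * u < 1) (hn : 0 < n) (hs : ((100 * s * n : ℕ) : ℝ) * u < 1)
    {S : Matrix (Fin s) (Fin m) ℝ} {A : Matrix (Fin m) (Fin n) ℝ} {B : Matrix (Fin s) (Fin n) ℝ}
    {R : Matrix (Fin n) (Fin n) ℝ} (hB : FlMatMul u S A B) (hR : FlHouseholderQR u B R) :
    ∃ E : Matrix (Fin s) (Fin n) ℝ, ‖E‖ ≤ C₁ 100 u m s n * (‖S‖ * ‖A‖) ∧
      ∀ x, vnorm (R *ᵥ x) = vnorm ((S * A + E) *ᵥ x) := by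
  obtain ⟨D, hD, hDB⟩ := hR.exists_gram_eq_norm_sub_le hu hn hs
  have hBA := hB.norm_sub_le hu hu1 hm
  have hg := gam_nonneg hu hs
  refine ⟨D - S * A, ?_, fun x => ?_⟩
  · have h1 : ‖D - S * A‖ ≤ ‖D - B‖ + ‖B - S * A‖ := norm_sub_le_norm_sub_add_norm_sub _ _ _
    have h2 : ‖B‖ ≤ ‖S‖ * ‖A‖ + Real.sqrt (s * n) * gam u m * (‖S‖ * ‖A‖) := by
      have e1 : ‖B‖ ≤ ‖B - S * A‖ + ‖S * A‖ := by
        simpa using norm_add_le (B - S * A) (S * A)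
      have e2 := Matrix.l2_opNorm_mul S A
      linarith
    have h3 := mul_le_mul_of_nonneg_left h2
      (show 0 ≤ Real.sqrt n * gam u (100 * s * n) by positivity)
    rw [C₁]
    linarith
  · rw [add_sub_cancel]
    exact (vnorm_mulVec_eq_of_gram_eq hD x).symm

/-- Write `(m/n + √n) n γ_n = m γ_n + √n (n γ_n)`. The first term is at most `n γ_m ≤ √(sn) γ_m`,
the second at most `√n γ_{100sn}`, and both bounds are summands of `C₁`. -/
theorem mul_gam_le_C₁ {u : ℝ} {m s n : ℕ} (hu : 0 ≤ u) (hn : 0 < n) (hns : n < s) (hsm : s < m)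
    (hm : m * u < 1) (hs : ((100 * s * n : ℕ) : ℝ) * u < 1)
    (h : (m : ℝ) / n + Real.sqrt n > 200) : 200 * (n * gam u n) ≤ C₁ 100 u m s n := by
  have hn1 : (1 : ℝ) ≤ n := by exact_mod_cast hn
  have hns' : (n : ℝ) ≤ s := by exact_mod_cast hns.le
  have hnm' : (n : ℝ) ≤ m := by exact_mod_cast (hns.trans hsm).le
  have hnu : (n : ℝ) * u ≤ m * u := by gcongr
  have hn' : (n : ℝ) * u < 1 := by linarith
  have hgn := gam_nonneg hu hn'
  have hgm := gam_nonneg hu hm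
  have hgs := gam_nonneg hu hs
  have h1 : m * gam u n ≤ Real.sqrt (s * n) * gam u m := by
    have e1 : (n : ℝ) ≤ Real.sqrt (s * n) := by
      refine Real.le_sqrt_of_sq_le ?_
      nlinarith
    have e2 : m * gam u n ≤ n * gam u m := by
      rw [gam, gam, mul_div_assoc', mul_div_assoc']
      rw [show (m : ℝ) * (n * u) = n * (m * u) by ring]
      exact div_le_div_of_nonneg_left (by positivity) (by linarith) (by linarith)
    exact e2.trans (mul_le_mul_of_nonneg_right e1 hgm)
  have h2 : n * gam u n ≤ gam u (100 * s * n) := by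
    rw [gam, gam, mul_div_assoc']
    push_cast at hs ⊢
    have e0 : (n : ℝ) * n * u ≤ s * n * u := by gcongr
    have e1 : (n : ℝ) * u ≤ n * n * u := by
      have := mul_le_mul_of_nonneg_right (le_mul_of_one_le_left (by linarith) hn1 : (n : ℝ) ≤ n * n)
        hu
      exact this
    exact div_le_div₀ (by positivity) (by nlinarith) (by linarith) (by nlinarith)
  have h3 := mul_le_mul_of_nonneg_left h2 (Real.sqrt_nonneg (n : ℝ))
  have h4 : 200 * (n * gam u n) ≤ ((m : ℝ) / n + Real.sqrt n) * (n * gam u n) := by gcongr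
  have h5 : ((m : ℝ) / n + Real.sqrt n) * (n * gam u n) =
      m * gam u n + Real.sqrt n * (n * gam u n) := by field_simp
  have h6 : 0 ≤ Real.sqrt n * gam u (100 * s * n) * (Real.sqrt (s * n) * gam u m) := by positivity
  rw [C₁]
  linarith

theorem diag_ne_zero_of_isUnit_det {n : ℕ} {R : Matrix (Fin n) (Fin n) ℝ}
    (hup : ∀ i j, j < i → R i j = 0) (hR : IsUnit R.det) (i : Fin n) : R i i ≠ 0 := by
  have h := hR.ne_zero
  rw [Matrix.det_of_isUpperTriangular fun i j hij => hup i j hij] at h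
  exact Finset.prod_ne_zero_iff.mp h i (Finset.mem_univ i)

theorem FlRightTriSolve.norm_residual_le {u : ℝ} {m n : ℕ} (hu : 0 ≤ u) (hu1 : u < 1)
    (hn : n * u < 1) {R : Matrix (Fin n) (Fin n) ℝ} (hup : ∀ i j, j < i → R i j = 0)
    (hd : ∀ i, R i i ≠ 0) {A Y : Matrix (Fin m) (Fin n) ℝ} (h : FlRightTriSolve u R A Y) :
    ‖A - Y * R‖ ≤ n * gam u n * (‖Y‖ * ‖R‖) := by
  have hg := gam_nonneg hu hn
  refine opNorm_le_of_frobSq_le (by positivity) ?_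
  refine (frobSq_le_of_abs_le (X := Y) (Z := R) (g := gam u n)
    fun i j => (h i).abs_residual_le hu hu1 hn hup hd j).trans ?_
  have h1 : frobSq Y * frobSq R ≤ (n * ‖Y‖ ^ 2) * (n * ‖R‖ ^ 2) :=
    mul_le_mul (frobSq_le_col Y) (frobSq_le_col R) (frobSq_nonneg R) (by positivity)
  calc _ ≤ gam u n ^ 2 * ((n * ‖Y‖ ^ 2) * (n * ‖R‖ ^ 2)) := by gcongr
    _ = _ := by ring

/-- A vector with a small residual solves a nearby system exactly. -/
theorem exists_mulVec_eq_of_vnorm_residual_le {m n : ℕ} {R : Matrix (Fin m) (Fin n) ℝ}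
    {z : Fin m → ℝ} {x : Fin n → ℝ} {c : ℝ} (hc : 0 ≤ c) (h : vnorm (z - R *ᵥ x) ≤ c * vnorm x) :
    ∃ ΔR : Matrix (Fin m) (Fin n) ℝ, ‖ΔR‖ ≤ c ∧ (R + ΔR) *ᵥ x = z := by
  by_cases hx : vnorm x = 0
  · refine ⟨0, by simpa using hc, ?_⟩
    rw [hx, mul_zero] at h
    have := vnorm_eq_zero.mp (le_antisymm h (vnorm_nonneg _))
    rw [add_zero, ← sub_eq_zero.mp this]
  · have hpos : 0 < vnorm x := lt_of_le_of_ne (vnorm_nonneg x) (Ne.symm hx)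
    set r := z - R *ᵥ x with hr
    have key : ∀ w, Matrix.vecMulVec r ((x ⬝ᵥ x)⁻¹ • x) *ᵥ w = ((x ⬝ᵥ x)⁻¹ * (x ⬝ᵥ w)) • r := by
      intro w
      ext i
      simp [Matrix.mulVec, Matrix.vecMulVec, dotProduct, Finset.mul_sum, Finset.sum_mul]
      refine Finset.sum_congr rfl fun j _ => by ring
    -- The rank-one matrix `r xᵀ / ‖x‖²` sends `x` to the residual `r` and has norm `‖r‖ / ‖x‖`.
    refine ⟨Matrix.vecMulVec r ((x ⬝ᵥ x)⁻¹ • x), opNorm_le hc fun w => ?_, ?_⟩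
    · rw [key, vnorm_smul, abs_mul, ← vnorm_sq, abs_of_pos (by positivity)]
      have h1 := abs_dotProduct_le x w
      calc (vnorm x ^ 2)⁻¹ * |x ⬝ᵥ w| * vnorm r
          ≤ (vnorm x ^ 2)⁻¹ * (vnorm x * vnorm w) * (c * vnorm x) := by
            have := vnorm_nonneg w
            gcongr
            exact vnorm_nonneg r
        _ = c * vnorm w := by field_simp
    · rw [Matrix.add_mulVec, key, inv_mul_cancel₀ (by rw [← vnorm_sq]; positivity), one_smul, hr,
        add_sub_cancel]

theorem FlBackSub.exists_mulVec_eq {u : ℝ} {n : ℕ} (hu : 0 ≤ u) (hu1 : u < 1) (hn : n * u < 1)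
    {R : Matrix (Fin n) (Fin n) ℝ} (hup : ∀ i j, j < i → R i j = 0) (hd : ∀ i, R i i ≠ 0)
    {z x : Fin n → ℝ} (h : FlBackSub u R z x) :
    ∃ ΔR : Matrix (Fin n) (Fin n) ℝ, ‖ΔR‖ ≤ Real.sqrt n * gam u n * ‖R‖ ∧
      (R + ΔR) *ᵥ x = z := by
  have hg := gam_nonneg hu hn
  refine exists_mulVec_eq_of_vnorm_residual_le (by positivity) ?_
  -- Vectors are treated as one-column matrices, so only `‖R‖_F ≤ √n ‖R‖` is lost.
  have h1 := frobSq_le_of_abs_le (F := Matrix.of fun i (_ : Fin 1) => (z - R *ᵥ x) i) (X := R)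
    (Z := Matrix.of fun k (_ : Fin 1) => x k) (g := gam u n)
    fun i _ => h.abs_residual_le hu hu1 hn hup hd i
  have hcol : ∀ {k : ℕ} (v : Fin k → ℝ), frobSq (Matrix.of fun i (_ : Fin 1) => v i) =
      vnorm v ^ 2 := by
    intro k v
    simp [frobSq, vnorm_sq_eq_sum]
  rw [hcol, hcol] at h1
  have := vnorm_nonneg x
  refine le_of_sq_le_sq (h1.trans ?_) (by positivity)
  rw [mul_pow, mul_pow, mul_pow, Real.sq_sqrt (by positivity)]
  calc _ ≤ gam u n ^ 2 * (n * ‖R‖ ^ 2 * vnorm x ^ 2) := by gcongr; exact frobSq_le_col R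
    _ = _ := by ring

/-! ### The preconditioned matrix -/

theorem linearIndependent_of_condNum_lt {m n : ℕ} {M : Matrix (Fin m) (Fin n) ℝ} {t : ℝ≥0∞}
    (h : condNum M < t) : LinearIndependent ℝ M.col := by
  by_contra hM
  rw [condNum, if_neg hM] at h
  exact not_top_lt h

theorem mul_norm_pinv_lt_of_condNum_lt {m n : ℕ} {M : Matrix (Fin m) (Fin n) ℝ} {t : ℝ}
    (h : condNum M < ENNReal.ofReal t) : ‖M‖ * ‖pinv M‖ < t := by
  have hM := linearIndependent_of_condNum_lt h
  rw [condNum, if_pos hM] at h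
  exact (ENNReal.ofReal_lt_ofReal_iff_of_nonneg (by positivity)).mp h

theorem one_le_norm_mul_norm_pinv {m n : ℕ} (hn : 0 < n) {M : Matrix (Fin m) (Fin n) ℝ}
    (hM : LinearIndependent ℝ M.col) : 1 ≤ ‖M‖ * ‖pinv M‖ := by
  set e : Fin n → ℝ := Pi.single ⟨0, hn⟩ 1
  have he : vnorm e = 1 := by rw [vnorm_eq_sqrt]; simp [e]
  have h1 := vnorm_le_pinv hM e
  have h2 := mul_le_mul_of_nonneg_left (vnorm_mulVec_le M e) (norm_nonneg (pinv M))
  rw [he] at h1 h2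
  linarith

theorem IsEconomyQR.vnorm_mulVec {m n : ℕ} {A Q : Matrix (Fin m) (Fin n) ℝ}
    {R : Matrix (Fin n) (Fin n) ℝ} (h : IsEconomyQR A Q R) (x : Fin n → ℝ) :
    vnorm (Q *ᵥ x) = vnorm x := by
  have h1 : Qᵀ * Q = (1 : Matrix (Fin n) (Fin n) ℝ)ᵀ * 1 := by simp [h.orthonormal]
  simpa using vnorm_mulVec_eq_of_gram_eq h1 x

/-- If `R` is the triangular factor of a small perturbation of `S A`, then `A R⁻¹` is bounded. -/
theorem vnorm_mulVec_le_of_sketch {m s n : ℕ} {A Q : Matrix (Fin m) (Fin n) ℝ}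
    {RA R : Matrix (Fin n) (Fin n) ℝ} {S : Matrix (Fin s) (Fin m) ℝ}
    {E : Matrix (Fin s) (Fin n) ℝ} {c : ℝ} (hA : LinearIndependent ℝ A.col)
    (hQ : IsEconomyQR A Q RA) (hSQ : LinearIndependent ℝ (S * Q).col)
    (hE : ‖E‖ ≤ c * (‖S‖ * ‖A‖)) (hR : ∀ x, vnorm (R *ᵥ x) = vnorm ((S * A + E) *ᵥ x))
    (hc : 3 * c * (‖S‖ * ‖pinv (S * Q)‖) * (‖A‖ * ‖pinv A‖) ≤ 1) (x : Fin n → ℝ) :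
    vnorm (A *ᵥ x) ≤ 3 / 2 * ‖pinv (S * Q)‖ * vnorm (R *ᵥ x) := by
  -- Apply the lower bound for `S Q` to `RA x`, whose norm is that of `A x`.
  have h1 : vnorm (A *ᵥ x) ≤ ‖pinv (S * Q)‖ * vnorm ((S * A) *ᵥ x) := by
    have := vnorm_le_pinv hSQ (RA *ᵥ x)
    rwa [Matrix.mulVec_mulVec, Matrix.mul_assoc, ← hQ.eq, ← hQ.vnorm_mulVec,
      Matrix.mulVec_mulVec, ← hQ.eq] at this
  have h2 : vnorm ((S * A) *ᵥ x) ≤ vnorm (R *ᵥ x) + ‖E‖ * vnorm x := by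
    have e1 := vnorm_add_le ((S * A + E) *ᵥ x) ((-1 : ℝ) • (E *ᵥ x))
    rw [vnorm_smul, ← hR] at e1
    have e2 : (S * A + E) *ᵥ x + (-1 : ℝ) • (E *ᵥ x) = (S * A) *ᵥ x := by
      rw [Matrix.add_mulVec, neg_one_smul, add_neg_cancel_right]
    rw [e2, abs_neg, abs_one, one_mul] at e1
    linarith [vnorm_mulVec_le E x]
  have h3 : ‖E‖ * vnorm x ≤ c * (‖S‖ * ‖A‖) * (‖pinv A‖ * vnorm (A *ᵥ x)) :=
    mul_le_mul hE (vnorm_le_pinv hA x) (vnorm_nonneg x) ((norm_nonneg E).trans hE)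
  have h4 := mul_le_mul_of_nonneg_left (h2.trans (add_le_add_right h3 _))
    (norm_nonneg (pinv (S * Q)))
  -- The contribution of `E` is at most a third of `‖A x‖`; absorbing it on the left gives the
  -- factor `3/2`.
  have h5 := mul_le_mul_of_nonneg_right hc (vnorm_nonneg (A *ᵥ x))
  linarith

end SketchApply

open SketchApply

/-! ### Backward error of the whole solver -/

theorem mainTheorem2 :
    ∃ c : ℕ, 0 < c ∧
      ∀ (m s n : ℕ) (u : ℝ) (A QA : Matrix (Fin m) (Fin n) ℝ) (RA : Matrix (Fin n) (Fin n) ℝ)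
        (S : Matrix (Fin s) (Fin m) ℝ),
        n < s → s < m → 0 < u →
        -- the quantities `γ_m` and `γ̃_{sn}` are meaningful
        m * u < 1 → ((c * s * n : ℕ) : ℝ) * u < 1 →
        LinearIndependent ℝ A.col → LinearIndependent ℝ S.row →
        IsEconomyQR A QA RA →
        condNum (S * QA) < 49 → (n : ℝ) ^ 2 * u < 1 / 201 → (m : ℝ) / n + Real.sqrt n > 200 →
        condNum A < ENNReal.ofReal (1 / (3 * C₁ c u m s n * kS S QA)) →
        -- the computed sketch, triangular factor and preconditioned matrix
        ∀ (B : Matrix (Fin s) (Fin n) ℝ) (R : Matrix (Fin n) (Fin n) ℝ)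
          (Y : Matrix (Fin m) (Fin n) ℝ),
        FlMatMul u S A B → FlHouseholderQR u B R → FlRightTriSolve u R A Y →
        -- the iterate returned by LSQR and the computed solution
        ∀ (b δb : Fin m → ℝ) (ΔY : Matrix (Fin m) (Fin n) ℝ) (z x : Fin n → ℝ),
        z = pinv (Y + ΔY) *ᵥ (b + δb) → FlBackSub u R z x →
        ∃ ΔA : Matrix (Fin m) (Fin n) ℝ,
          IsLeastSquaresSolution (A + ΔA) (b + δb) x ∧
          ‖ΔA‖ < ‖S‖ * ‖A‖ * (6.04 * n * gam u n * ‖pinv (S * QA)‖ + 2.01 * ‖ΔY‖) := by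
  refine ⟨100, by norm_num, ?_⟩
  intro m s n u A QA RA S hns hsm hu hm hs hA _ hQ hκS hn2 hmn hκA B R Y hB hR hY b δb ΔY z x hz hx
  have hn : 0 < n := by
    rcases Nat.eq_zero_or_pos n with rfl | h
    · norm_num at hmn
    · exact h
  have hn1 : (1 : ℝ) ≤ n := by exact_mod_cast hn
  have hnm : (n : ℝ) ≤ m := by exact_mod_cast (hns.trans hsm).le
  have hnu : (n : ℝ) * u < 1 := lt_of_le_of_lt (by gcongr) hm
  have hu1 : u < 1 := lt_of_le_of_lt (le_mul_of_one_le_left hu.le hn1) hnu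
  have hSQ := linearIndependent_of_condNum_lt hκS
  obtain ⟨E, hE, hRE⟩ := exists_sketch_perturbation hu.le hu1 hm hn hs hB hR
  have hCg := mul_gam_le_C₁ hu.le hn hns hsm hm hs hmn
  -- scalar quantities
  have hgpos : 0 < n * gam u n :=
    mul_pos (by linarith) (div_pos (mul_pos (by linarith) hu) (by linarith))
  -- Here `n γ_n = n² u / (1 - n u)` with `n u ≤ n² u < 1/201`.
  have hgsmall : n * gam u n ≤ 1 / 200 := by
    have e : (n : ℝ) * u ≤ n ^ 2 * u := by
      gcongr
      nlinarith
    rw [gam, mul_div_assoc', div_le_iff₀ (by linarith)]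
    nlinarith
  have hsqrt : Real.sqrt n * gam u n ≤ n * gam u n := by
    have hg := gam_nonneg hu.le hnu
    gcongr
    exact Real.sqrt_le_iff.mpr ⟨by linarith, by nlinarith⟩
  have hκ := mul_norm_pinv_lt_of_condNum_lt hκA
  have hA1 := one_le_norm_mul_norm_pinv hn hA
  have hS1 : 1 ≤ kS S QA := by
    refine (one_le_norm_mul_norm_pinv hn hSQ).trans ?_
    have hQ1 : ‖QA‖ ≤ 1 := opNorm_le zero_le_one fun x => by rw [hQ.vnorm_mulVec, one_mul]
    have := (Matrix.l2_opNorm_mul S QA).trans (mul_le_of_le_one_right (norm_nonneg S) hQ1)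
    exact mul_le_mul_of_nonneg_right this (norm_nonneg _)
  have hupR := hR.upper
  set g := n * gam u n with hgdef
  set C := C₁ 100 u m s n with hC
  have hC0 : 0 < C := by linarith
  have hκ3 : 3 * C * kS S QA * (‖A‖ * ‖pinv A‖) < 1 := by
    rwa [lt_div_iff₀ (by positivity), mul_comm] at hκ
  -- Both `k(S)` and `κ₂(A)` are at least `1`.
  have hC3 : C ≤ 1 / 3 := by
    have e1 : 3 * C * 1 ≤ 3 * C * kS S QA := by gcongr
    have e2 : 3 * C * kS S QA * 1 ≤ 3 * C * kS S QA * (‖A‖ * ‖pinv A‖) := by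
      have : 0 ≤ 3 * C * kS S QA := by linarith
      gcongr
    linarith
  rw [kS] at hκ3 hS1
  have hAR := vnorm_mulVec_le_of_sketch hA hQ hSQ hE hRE hκ3.le
  set p := ‖pinv (S * QA)‖ with hp
  set q := ‖pinv A‖ with hq
  have hp0 : 0 ≤ p := norm_nonneg _
  have hq0 : 0 ≤ q := norm_nonneg _
  have hSn := norm_nonneg S
  have hAn := norm_nonneg A
  have hppos : 0 < p := by
    rcases hp0.eq_or_lt with h | h
    · rw [← h] at hS1; linarith
    · exact h
  have hSA : 0 < ‖S‖ * ‖A‖ := by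
    refine mul_pos (lt_of_le_of_ne hSn fun h => ?_) (lt_of_le_of_ne hAn fun h => ?_)
    · rw [← h] at hS1; linarith
    · rw [← h] at hA1; linarith
  -- bounds for the triangular factor
  have hRn : ‖R‖ ≤ 4 / 3 * (‖S‖ * ‖A‖) := by
    refine opNorm_le (by positivity) fun x => ?_
    rw [hRE]
    refine (vnorm_mulVec_le _ x).trans (mul_le_mul_of_nonneg_right ?_ (vnorm_nonneg x))
    have e1 := norm_add_le (S * A) E
    have e2 := Matrix.l2_opNorm_mul S A
    have e3 := mul_le_mul_of_nonneg_right hC3 hSA.le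
    linarith
  have hxR : ∀ x, vnorm x ≤ 3 / 2 * p * q * vnorm (R *ᵥ x) := fun x => by
    have := mul_le_mul_of_nonneg_left (hAR x) hq0
    linarith [vnorm_le_pinv hA x]
  have hdet : IsUnit R.det := by
    rw [← Matrix.isUnit_iff_isUnit_det, ← Matrix.mulVec_injective_iff_isUnit]
    intro v w hvw
    have h1 := hxR (v - w)
    rw [Matrix.mulVec_sub, show R *ᵥ v = R *ᵥ w from hvw, sub_self, vnorm_zero, mul_zero] at h1
    exact sub_eq_zero.mp (vnorm_eq_zero.mp (le_antisymm h1 (vnorm_nonneg _)))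
  have hd := diag_ne_zero_of_isUnit_det hupR hdet
  have hcancel : ∀ w, R *ᵥ (R⁻¹ *ᵥ w) = w := fun w => by
    rw [Matrix.mulVec_mulVec, Matrix.mul_nonsing_inv R hdet, Matrix.one_mulVec]
  have hRinv : ‖R⁻¹‖ ≤ 3 / 2 * p * q := by
    refine opNorm_le (by positivity) fun w => ?_
    have := hxR (R⁻¹ *ᵥ w)
    rwa [hcancel] at this
  have hARinv : ‖A * R⁻¹‖ ≤ 3 / 2 * p := by
    refine opNorm_le (by positivity) fun w => ?_
    have := hAR (R⁻¹ *ᵥ w)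
    rwa [hcancel, Matrix.mulVec_mulVec] at this
  -- bound for the preconditioned matrix
  have hF := hY.norm_residual_le hu.le hu1 hnu hupR hd
  rw [← hgdef] at hF
  -- Implicit bound: `‖Y‖ ≤ 3/2 p + ‖Y‖ / 300`, since `2 g k(S) κ₂(A) ≤ C k(S) κ₂(A) / 100 ≤ 1/300`;
  -- and `1.5 · 300/299 < 1.51`.
  have hYn : ‖Y‖ ≤ 1.51 * p := by
    have e1 : Y = A * R⁻¹ - (A - Y * R) * R⁻¹ := by
      rw [← Matrix.sub_mul, sub_sub_cancel, Matrix.mul_assoc, Matrix.mul_nonsing_inv R hdet,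
        Matrix.mul_one]
    have e2 : ‖Y‖ ≤ ‖A * R⁻¹‖ + ‖A - Y * R‖ * ‖R⁻¹‖ := by
      conv_lhs => rw [e1]
      exact (norm_sub_le _ _).trans (add_le_add_right (Matrix.l2_opNorm_mul _ _) _)
    have e3 : ‖A - Y * R‖ * ‖R⁻¹‖ ≤
        g * (‖Y‖ * (4 / 3 * (‖S‖ * ‖A‖))) * (3 / 2 * p * q) := by
      refine mul_le_mul (hF.trans ?_) hRinv (norm_nonneg _) (by positivity)
      gcongr
    have e4 : g * (2 * (‖S‖ * p) * (‖A‖ * q)) ≤ 1 / 300 := by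
      have : 200 * g * ((‖S‖ * p) * (‖A‖ * q)) ≤ C * ((‖S‖ * p) * (‖A‖ * q)) := by gcongr
      linarith
    have e5 := mul_le_mul_of_nonneg_right e4 (norm_nonneg Y)
    linarith
  -- the backward error
  obtain ⟨ΔR, hΔR, hΔRx⟩ := hx.exists_mulVec_eq hu.le hu1 hnu hupR hd
  have hΔR' : ‖ΔR‖ ≤ g * ‖R‖ := hΔR.trans (mul_le_mul_of_nonneg_right hsqrt (norm_nonneg R))
  refine ⟨(Y + ΔY) * (R + ΔR) - A, ?_, ?_⟩
  -- Since `z` is optimal among all vectors, it beats `(R + ΔR) y` in particular; invertibility of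
  -- `R + ΔR` is not needed.
  · intro y
    rw [add_sub_cancel, ← Matrix.mulVec_mulVec, ← Matrix.mulVec_mulVec, hΔRx, hz]
    exact isLeastSquaresSolution_pinv (Y + ΔY) (b + δb) _
  · have e1 : (Y + ΔY) * (R + ΔR) - A = -(A - Y * R) + Y * ΔR + ΔY * (R + ΔR) := by
      rw [Matrix.add_mul, Matrix.mul_add Y]; abel
    have e2 : ‖Y * ΔR‖ ≤ g * (‖Y‖ * ‖R‖) := by
      refine (Matrix.l2_opNorm_mul _ _).trans ?_
      have := mul_le_mul_of_nonneg_left hΔR' (norm_nonneg Y)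
      linarith
    have e3 : ‖ΔY * (R + ΔR)‖ ≤ ‖ΔY‖ * (201 / 200 * ‖R‖) := by
      refine (Matrix.l2_opNorm_mul _ _).trans (mul_le_mul_of_nonneg_left ?_ (norm_nonneg _))
      have := mul_le_mul_of_nonneg_right hgsmall (norm_nonneg R)
      linarith [norm_add_le R ΔR]
    have e4 : g * (‖Y‖ * ‖R‖) ≤ g * ((1.51 * p) * (4 / 3 * (‖S‖ * ‖A‖))) := by gcongr
    have e5 : ‖ΔY‖ * (201 / 200 * ‖R‖) ≤ ‖ΔY‖ * (201 / 200 * (4 / 3 * (‖S‖ * ‖A‖))) := by gcongr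
    have e6 := norm_add₃_le (a := -(A - Y * R)) (b := Y * ΔR) (c := ΔY * (R + ΔR))
    rw [norm_neg] at e6
    -- The bounds obtained are `2 · 1.51 · 4/3 < 6.04` and `201/200 · 4/3 < 2.01`. Strictness comes
    -- from this first term, as `ΔY` may vanish.
    have e7 : 0 < ‖S‖ * ‖A‖ * (g * p) := by positivity
    have e8 : 0 ≤ ‖S‖ * ‖A‖ * ‖ΔY‖ := by positivity
    rw [e1, mul_assoc (6.04 : ℝ), ← hgdef]
    linarith
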